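/- Conventions. A graph $G=(V(G),E(G))$ is a set $V(G)$ with a symmetric subset $E(G)\subset V(G)\times V(G)$ (undirected, loops allowed, no multiple edges). The girth of $G$ is the minimal length of a cycle embedded in $G$, where a looped vertex counts as a cycle of length $1$ and all other cycles have length at least $3$; it is $+\infty$ if $G$ contains no cycle. For graphs $T$ and $G$, $\mathrm{Hom}(T,G)$ is the poset of all maps $\eta:V(T)\to 2^{V(G)}\setminus\{\emptyset\}$ such that $(x,y)\in E(T)$ implies $\eta(x)\times\eta(y)\subset E(G)$, ordered by $\eta\le\eta'$ if and only if $\eta(x)\subset\eta'(x)$ for all $x\in V(T)$. A graph homomorphism $g:G\to H$ induces the order-preserving map $g_*:\mathrm{Hom}(T,G)\to\mathrm{Hom}(T,H)$, $g_*(\eta)(x)=g(\eta(x))$. An order-preserving map $f:P\to Q$ of posets is called a homotopy equivalence if the continuous map $|f|:|P|\to|Q|$ between the geometric realizations of the order complexes is a homotopy equivalence. For an edge $e$ of $G$ joining $v$ and $w$, the graph $G_e$ has vertex set $V(G)\sqcup\{0,1\}$, and is obtained from $G$ by removing the edge $e$ (in both orientations) and adding the undirected edges joining $v$ to $0$, $0$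 to $1$, and $1$ to $w$; the graph homomorphism $r_e:G_e\to G$ is the identity on $V(G)$ and sends $0\mapsto w$ and $1\mapsto v$. Proposition 4.5. Let $T$ be a finite connected bipartite graph of diameter $\Delta>0$, and let $X$ be a finite graph with girth greater than $2\Delta+4$. Then for every edge $e$ of $X$, the map $r_{e*}:\mathrm{Hom}(T,X_e)\to\mathrm{Hom}(T,X)$ induced by $r_e$ is a homotopy equivalence. -/

import Mathlib

/-! ## Finite posets and their classifying spaces -/

/-- The underlying set of the classifying space `|P|` of a poset `P`, that is, of the geometric
realization of the order complex of `P`, in barycentric coordinates: a point is a finitely supported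
family of non-negative real numbers with sum `1` whose support is a (finite) chain of `P`. -/
def ClassifyingSpace (P : Type*) [PartialOrder P] : Type _ :=
  {x : P →₀ ℝ // (∀ p, 0 ≤ x p) ∧ (x.sum fun _ a => a) = 1 ∧ IsChain (· ≤ ·) (x.support : Set P)}

namespace ClassifyingSpace

/-- The topology of the classifying space of a finite poset: the subspace topology of the
finite-dimensional space `ℝ ^ P`. (Only finite posets get a topology here. For them the order
complex is a finite simplicial complex, and this is the weak topology as well.) -/
instance {P : Type*} [PartialOrder P] [Finite P] : TopologicalSpace (ClassifyingSpace P) :=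
  TopologicalSpace.induced (fun x : ClassifyingSpace P => (fun p => x.1 p : P → ℝ)) inferInstance

/-- The map `|f| : |P| → |Q|` induced by an order-preserving map `f`: the simplicial map sending
the vertex `p` to the vertex `f p`, extended affinely to each simplex. -/
noncomputable def mapFun {P Q : Type*} [PartialOrder P] [PartialOrder Q] (f : P →o Q)
    (x : ClassifyingSpace P) : ClassifyingSpace Q :=
  ⟨x.1.mapDomain f, by
    classical
    obtain ⟨x, hx0, hx1, hxc⟩ := x
    refine ⟨fun q => ?_, ?_, ?_⟩
    · rw [Finsupp.mapDomain, Finsupp.sum_apply]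
      refine Finset.sum_nonneg fun p _ => ?_
      change 0 ≤ (Finsupp.single (f p) (x p)) q
      rw [Finsupp.single_apply]
      split_ifs
      · exact hx0 p
      · exact le_rfl
    · rw [Finsupp.sum_mapDomain_index (fun _ => rfl) (fun _ _ _ => rfl)]
      exact hx1
    · intro a ha b hb hab
      have ha' := Finsupp.mapDomain_support ha
      have hb' := Finsupp.mapDomain_support hb
      obtain ⟨p, hp, rfl⟩ := Finset.mem_image.1 ha'
      obtain ⟨q, hq, rfl⟩ := Finset.mem_image.1 hb'
      have hpq : p ≠ q := fun h => hab (h ▸ rfl)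
      exact (hxc hp hq hpq).imp (fun h => f.monotone h) (fun h => f.monotone h)⟩

end ClassifyingSpace

/-- An order-preserving map `f : P → Q` between finite posets is a homotopy equivalence if the map
`|f| : |P| → |Q|` is (the underlying map of) a homotopy equivalence of topological spaces. -/
def IsPosetHomotopyEquiv {P Q : Type*} [PartialOrder P] [PartialOrder Q] [Finite P] [Finite Q]
    (f : P →o Q) : Prop :=
  ∃ h : ContinuousMap.HomotopyEquiv (ClassifyingSpace P) (ClassifyingSpace Q),
    ∀ x, h x = ClassifyingSpace.mapFun f x

/-! ## Graphs, possibly with loops -/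

/-- A graph on the vertex set `V`: undirected, loops allowed, no multiple edges. -/
structure LoopGraph (V : Type*) where
  /-- Adjacency: membership of `(v, w)` in the edge set. -/
  Adj : V → V → Prop
  symm : ∀ v w, Adj v w → Adj w v

namespace LoopGraph

variable {V W : Type*}

/-- The simple graph obtained by forgetting the loops. -/
def toSimple (G : LoopGraph V) : SimpleGraph V where
  Adj v w := v ≠ w ∧ G.Adj v w
  symm := ⟨fun v w h => ⟨h.1.symm, G.symm v w h.2⟩⟩
  loopless := ⟨fun _ h => h.1 rfl⟩

/-- Connectedness (loops are irrelevant for it); a connected graph has a vertex. -/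
def Connected (G : LoopGraph V) : Prop := G.toSimple.Connected

/-- `G` is bipartite: it has a proper colouring with two colours. In particular it has no loop. -/
def IsBipartite (G : LoopGraph V) : Prop := ∃ c : V → Bool, ∀ v w, G.Adj v w → c v ≠ c w

/-- The diameter, i.e. the maximum of the path distances (loops are irrelevant for it). It is the
true diameter for finite connected graphs. -/
noncomputable def diam (G : LoopGraph V) : ℕ := G.toSimple.diam

open Classical in
/-- The girth: the minimal length of an embedded cycle, `⊤` if there is none. A looped vertex is an
embedded cycle of length `1`; every other embedded cycle is a cycle, of length at least `3`, of the
underlying simple graph. -/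
noncomputable def girth (G : LoopGraph V) : ℕ∞ :=
  if ∃ v, G.Adj v v then 1 else G.toSimple.egirth

/-- For an edge `e = ⟨v, w⟩` of `G`, the graph `G_e`: its vertices are those of `G` and two new ones
`0`, `1`; the edge `⟨v, w⟩` is removed, and the edges `⟨v, 0⟩`, `⟨0, 1⟩`, `⟨1, w⟩` are added. -/
def subdivideEdge (G : LoopGraph V) (v w : V) : LoopGraph (V ⊕ Fin 2) where
  Adj
    | Sum.inl a, Sum.inl b => G.Adj a b ∧ s(a, b) ≠ s(v, w)
    | Sum.inl a, Sum.inr i => (a = v ∧ i = 0) ∨ (a = w ∧ i = 1)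
    | Sum.inr i, Sum.inl a => (a = v ∧ i = 0) ∨ (a = w ∧ i = 1)
    | Sum.inr i, Sum.inr j => i ≠ j
  symm := by
    rintro (a | i) (b | j) h
    · exact ⟨G.symm _ _ h.1, fun h' => h.2 (Sym2.eq_swap.trans h')⟩
    · exact h
    · exact h
    · exact Ne.symm h

/-- The graph homomorphism `r_e : G_e → G`: the identity on the vertices of `G`, and `0 ↦ w`,
`1 ↦ v`. -/
def subdivideEdgeHom (G : LoopGraph V) {v w : V} (e : G.Adj v w) :
    (G.subdivideEdge v w).Adj →r G.Adj where
  toFun := Sum.elim id ![w, v]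
  map_rel' := by
    rintro (a | i) (b | j) h
    · exact h.1
    · rcases h with ⟨rfl, rfl⟩ | ⟨rfl, rfl⟩
      · exact e
      · exact G.symm _ _ e
    · rcases h with ⟨rfl, rfl⟩ | ⟨rfl, rfl⟩
      · exact G.symm _ _ e
      · exact e
    · fin_cases i <;> fin_cases j
      · exact absurd rfl h
      · exact G.symm _ _ e
      · exact e
      · exact absurd rfl h

/-! ## Hom complexes -/

/-- The elements of the Hom complex `Hom(T, G)`: the multi-homomorphisms from `T` to `G`. -/
@[ext]
structure HomComplex (T : LoopGraph V) (G : LoopGraph W) where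
  toFun : V → Set W
  nonempty : ∀ v, (toFun v).Nonempty
  adj : ∀ v w, T.Adj v w → ∀ x ∈ toFun v, ∀ y ∈ toFun w, G.Adj x y

namespace HomComplex

variable {T : LoopGraph V} {G : LoopGraph W}

theorem toFun_injective : Function.Injective (toFun : HomComplex T G → V → Set W) :=
  fun _ _ h => HomComplex.ext h

/-- The order on `Hom(T, G)`: `η ≤ η'` iff `η v ⊆ η' v` for every vertex `v`. -/
instance : PartialOrder (HomComplex T G) := PartialOrder.lift toFun toFun_injective

instance [Finite V] [Finite W] : Finite (HomComplex T G) := Finite.of_injective _ toFun_injective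

/-- The order-preserving map `g_* : Hom(T, G) → Hom(T, H)` induced by a graph homomorphism
`g : G → H`, given by `(g_* η) v = g (η v)`. -/
def map {W' : Type*} {H : LoopGraph W'} (T : LoopGraph V) (g : G.Adj →r H.Adj) :
    HomComplex T G →o HomComplex T H where
  toFun η :=
    { toFun := fun v => g '' η.toFun v
      nonempty := fun v => (η.nonempty v).image g
      adj := by
        rintro v w h _ ⟨x, hx, rfl⟩ _ ⟨y, hy, rfl⟩
        exact g.map_rel (η.adj v w h x hx y hy) }
  monotone' := fun _ _ h v => Set.image_mono (h v)

end HomComplex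

end LoopGraph

/-! Fix an edge of `T`. Restriction to it gives a commutative square comparing `Hom(T, X_e) → Hom(T,
X)` with `Hom(K₂, X_e) → Hom(K₂, X)`. The two restriction maps and the map between the
`K₂`-complexes are homotopy equivalences, hence so is the remaining side
(`IsPosetHomotopyEquiv.of_comp_left`).

All three follow from Quillen's fiber lemma (`IsPosetHomotopyEquiv.of_fibers`), whose fibers are
contracted by fences of order-preserving self-maps; the fences come from foldings of the target
graph (`ListHom.exists_fenced_fold`).

For the restriction maps: without short cycles an element of `Hom(K₂, G)` is a star, with a single
value `c` at one end. In the fiber over it all values stay within distance `Δ + 1` of `c`, where the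
girth bound makes the step towards `c` unique. Folding the outermost layer inwards again and again
leaves the star of `c`, and that part has a maximum (`orderContractible_star`). This applies to `X`
and also to `X_e`, as subdividing creates no short cycle (`forestUpTo_subdivideEdge`).

For the `K₂`-complexes: the fiber over a star avoiding `e` has a maximum; otherwise one ray of the
star is replaced by a path of length three, which folds back.

The fiber lemma itself comes from the mapping cylinder and from removing, one at a time, points
whose strict lower set is contractible. -/

/-! ## Classifying spaces of finite posets up to homotopy -/

namespace ClassifyingSpace

open Topology unitInterval

section Basic

variable {P Q R : Type*} [PartialOrder P] [PartialOrder Q] [PartialOrder R]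

/-- The barycentric coordinates of a point. -/
def coord (x : ClassifyingSpace P) (p : P) : ℝ := x.1 p

instance : CoeFun (ClassifyingSpace P) fun _ => P → ℝ := ⟨coord⟩

@[ext]
theorem ext {x y : ClassifyingSpace P} (h : ∀ p, x p = y p) : x = y :=
  Subtype.ext (Finsupp.ext h)

theorem nonneg (x : ClassifyingSpace P) (p : P) : 0 ≤ x p := x.2.1 p

theorem sum_eq_one [Fintype P] (x : ClassifyingSpace P) : ∑ p, x p = 1 := by
  have h := x.2.2.1
  rwa [Finsupp.sum_fintype _ _ fun _ => rfl] at h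

theorem comparable (x : ClassifyingSpace P) {p q : P} (hp : x p ≠ 0) (hq : x q ≠ 0) :
    p ≤ q ∨ q ≤ p :=
  x.2.2.2.total (Finsupp.mem_support_iff.2 hp) (Finsupp.mem_support_iff.2 hq)

theorem le_one [Finite P] (x : ClassifyingSpace P) (p : P) : x p ≤ 1 := by
  have := Fintype.ofFinite P
  rw [← x.sum_eq_one]
  exact Finset.single_le_sum (fun q _ => x.nonneg q) (Finset.mem_univ p)

/-- The point with given barycentric coordinates. -/
noncomputable def mk [Fintype P] (x : P → ℝ) (h0 : ∀ p, 0 ≤ x p) (h1 : ∑ p, x p = 1)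
    (hc : ∀ p q, x p ≠ 0 → x q ≠ 0 → p ≤ q ∨ q ≤ p) : ClassifyingSpace P :=
  ⟨Finsupp.equivFunOnFinite.symm x, h0, by
    rw [Finsupp.sum_fintype _ _ fun _ => rfl]; exact h1, by
    intro p hp q hq _
    exact hc p q (Finsupp.mem_support_iff.1 hp) (Finsupp.mem_support_iff.1 hq)⟩

@[simp]
theorem mk_apply [Fintype P] (x : P → ℝ) (h0 h1 hc) (p : P) :
    (mk x h0 h1 hc : ClassifyingSpace P) p = x p := rfl

open Classical in
theorem mapFun_apply [Fintype P] (f : P →o Q) (x : ClassifyingSpace P) (q : Q) :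
    mapFun f x q = ∑ p, if f p = q then x p else 0 := by
  change (Finsupp.mapDomain f x.1) q = _
  rw [Finsupp.mapDomain, Finsupp.sum_apply, Finsupp.sum_fintype]
  · simp only [Finsupp.single_apply]
    rfl
  · simp

variable [Finite P]

theorem continuous_coe : Continuous fun x : ClassifyingSpace P => (x : P → ℝ) :=
  continuous_induced_dom

theorem continuous_eval (p : P) : Continuous fun x : ClassifyingSpace P => x p :=
  (continuous_apply p).comp continuous_coe

theorem continuous_iff {X : Type*} [TopologicalSpace X] {f : X → ClassifyingSpace P} :
    Continuous f ↔ ∀ p, Continuous fun x => f x p :=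
  continuous_induced_rng.trans continuous_pi_iff

theorem mapFun_ne_zero {f : P →o Q} {x : ClassifyingSpace P} {q : Q} (h : mapFun f x q ≠ 0) :
    ∃ p, f p = q ∧ x p ≠ 0 := by
  classical
  have := Fintype.ofFinite P
  rw [mapFun_apply] at h
  obtain ⟨p, -, hp⟩ := Finset.exists_ne_zero_of_sum_ne_zero h
  by_cases hpq : f p = q
  · exact ⟨p, hpq, by simpa [hpq] using hp⟩
  · simp [hpq] at hp

variable [Finite Q] [Finite R]

theorem continuous_mapFun (f : P →o Q) : Continuous (mapFun f) := by
  classical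
  have := Fintype.ofFinite P
  refine continuous_iff.2 fun q => ?_
  simp only [mapFun_apply]
  refine continuous_finsetSum _ fun p _ => ?_
  split_ifs
  · exact continuous_eval p
  · exact continuous_const

/-- The continuous map `|f|`. -/
noncomputable def map (f : P →o Q) : C(ClassifyingSpace P, ClassifyingSpace Q) :=
  ⟨mapFun f, continuous_mapFun f⟩

theorem map_id : map (OrderHom.id : P →o P) = ContinuousMap.id _ := by
  ext x p
  change Finsupp.mapDomain id x.1 p = x p
  rw [Finsupp.mapDomain_id]
  rfl

theorem map_comp (g : Q →o R) (f : P →o Q) : map (g.comp f) = (map g).comp (map f) := by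
  ext x p
  change Finsupp.mapDomain (g ∘ f) x.1 p = Finsupp.mapDomain g (Finsupp.mapDomain f x.1) p
  rw [Finsupp.mapDomain_comp]

/-- The vertex of `|P|` corresponding to `p`. -/
noncomputable def vertex (p : P) : ClassifyingSpace P :=
  letI := Fintype.ofFinite P
  letI := Classical.decEq P
  mk (Pi.single p 1) (fun q => by
      by_cases h : q = p
      · subst h; simp
      · simp [h])
    (by simp) (by
      intro q r hq hr
      have hq' : q = p := by by_contra h; simp [h] at hq
      have hr' : r = p := by by_contra h; simp [h] at hr
      exact Or.inl (by rw [hq', hr']))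

theorem map_const (p : Q) (x : ClassifyingSpace P) : map (OrderHom.const P p) x = vertex p := by
  classical
  have := Fintype.ofFinite P
  ext q
  change mapFun _ x q = (Pi.single p 1 : Q → ℝ) q
  rw [mapFun_apply]
  by_cases h : q = p
  · subst h; simp [x.sum_eq_one]
  · simp [h, Ne.symm h]

end Basic

/-! ### Homotopies from comparable order-preserving maps. -/

section Homotopy

variable {P Q : Type*} [PartialOrder P] [PartialOrder Q] [Finite P] [Finite Q]

/-- Contiguous maps are homotopic, by a straight line homotopy. -/
theorem homotopic_of_contiguous (f g : P →o Q)
    (h : ∀ p p', p ≤ p' → (f p ≤ g p' ∨ g p' ≤ f p) ∧ (g p ≤ f p' ∨ f p' ≤ g p)) :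
    (map f).Homotopic (map g) := by
  have := Fintype.ofFinite Q
  let F : I × ClassifyingSpace P → ClassifyingSpace Q := fun z =>
    mk (fun q => (1 - (z.1 : ℝ)) * map f z.2 q + z.1 * map g z.2 q)
      (fun q => add_nonneg (mul_nonneg (sub_nonneg.2 z.1.2.2) (nonneg _ _))
        (mul_nonneg z.1.2.1 (nonneg _ _)))
      (by rw [Finset.sum_add_distrib, ← Finset.mul_sum, ← Finset.mul_sum, sum_eq_one, sum_eq_one]
          ring)
      (by
        intro q r hq hr
        -- The support of the convex combination lies in the union of the images under `f` and `g`
        -- of the support of `z.2`, a chain.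
        have key : ∀ q, (1 - (z.1 : ℝ)) * map f z.2 q + z.1 * map g z.2 q ≠ 0 →
            ∃ p, z.2 p ≠ 0 ∧ (f p = q ∨ g p = q) := by
          intro q hq
          by_cases h1 : map f z.2 q = 0
          · by_cases h2 : map g z.2 q = 0
            · simp [h1, h2] at hq
            · obtain ⟨p, hp, hp'⟩ := mapFun_ne_zero h2
              exact ⟨p, hp', Or.inr hp⟩
          · obtain ⟨p, hp, hp'⟩ := mapFun_ne_zero h1
            exact ⟨p, hp', Or.inl hp⟩
        obtain ⟨p, hp, hpq⟩ := key q hq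
        obtain ⟨p', hp', hpr⟩ := key r hr
        rcases z.2.comparable hp hp' with hle | hle
        · have := h _ _ hle
          rcases hpq with rfl | rfl <;> rcases hpr with rfl | rfl
          · exact Or.inl (f.monotone hle)
          · exact this.1
          · exact this.2
          · exact Or.inl (g.monotone hle)
        · have := h _ _ hle
          rcases hpq with rfl | rfl <;> rcases hpr with rfl | rfl
          · exact Or.inr (f.monotone hle)
          · exact this.2.symm
          · exact this.1.symm
          · exact Or.inr (g.monotone hle))
  refine ⟨⟨⟨F, continuous_iff.2 fun q => ?_⟩, fun x => ?_, fun x => ?_⟩⟩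
  · change Continuous fun z : I × ClassifyingSpace P =>
      (1 - (z.1 : ℝ)) * map f z.2 q + z.1 * map g z.2 q
    have h1 := (continuous_eval q).comp ((map f).continuous.comp (continuous_snd (X := I)))
    have h2 := (continuous_eval q).comp ((map g).continuous.comp (continuous_snd (X := I)))
    have h3 : Continuous fun z : I × ClassifyingSpace P => (z.1 : ℝ) :=
      continuous_subtype_val.comp continuous_fst
    exact ((continuous_const.sub h3).mul h1).add (h3.mul h2)
  · ext q; simp [F]
  · ext q; simp [F]

/-- Comparable maps are homotopic. -/
theorem homotopic_of_le {f g : P →o Q} (hfg : f ≤ g) : (map f).Homotopic (map g) := by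
  classical
  have := Fintype.ofFinite P
  induction hn : (Finset.univ.filter fun p => f p ≠ g p).card using Nat.strong_induction_on
    generalizing f with
  | _ n ih =>
  by_cases hne : (Finset.univ.filter fun p => f p ≠ g p).Nonempty
  -- A single straight-line homotopy can fail: for `p < p'` nothing compares `g p` with `f p'`.
  -- Values are therefore changed one point at a time. At a maximal point of disagreement the
  -- changed map is still monotone, because `f` already equals `g` above it.
  · obtain ⟨p, hp⟩ := Finset.exists_maximal hne
    have hpne : f p ≠ g p := by simpa using hp.prop
    have hmax : ∀ p', p < p' → f p' = g p' := by
      intro p' hlt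
      by_contra h
      exact hlt.not_ge (hp.le_of_ge (by simpa using h) hlt.le)
    let f' : P →o Q := ⟨Function.update f p (g p), by
      intro a b hab
      by_cases ha : a = p <;> by_cases hb : b = p
      · rw [ha, hb]
      · subst ha
        rw [Function.update_self, Function.update_of_ne hb,
          hmax b (lt_of_le_of_ne hab (Ne.symm hb))]
        exact g.monotone hab
      · subst hb
        rw [Function.update_self, Function.update_of_ne ha]
        exact (f.monotone hab).trans (hfg _)
      · rw [Function.update_of_ne ha, Function.update_of_ne hb]
        exact f.monotone hab⟩
    have hf'p : f' p = g p := Function.update_self p (g p) f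
    have hf' : ∀ a, a ≠ p → f' a = f a := fun a ha => Function.update_of_ne ha (g p) f
    have hff' : f ≤ f' := by
      intro a
      by_cases ha : a = p
      · subst ha; rw [hf'p]; exact hfg a
      · rw [hf' a ha]
    have h1 : (map f).Homotopic (map f') := by
      refine homotopic_of_contiguous f f' fun a b hab => ⟨Or.inl ?_, ?_⟩
      · exact (f.monotone hab).trans (hff' b)
      · by_cases ha : a = p
        · by_cases hb : b = p
          · right; rw [ha, hb]; exact hff' p
          · left
            rw [← hf' b hb]
            exact f'.monotone hab
        · left
          rw [hf' a ha]
          exact f.monotone hab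
    refine h1.trans (ih _ ?_ (f := f') ?_ rfl)
    · rw [← hn]
      refine Finset.card_lt_card (Finset.ssubset_iff_subset_ne.2 ⟨?_, ?_⟩)
      · intro a
        simp only [Finset.mem_filter, Finset.mem_univ, true_and]
        intro h hfa
        apply h
        by_cases ha : a = p
        · rw [ha, hf'p]
        · rw [hf' a ha, hfa]
      · intro h
        have : p ∈ Finset.univ.filter fun p => f' p ≠ g p := by rw [h]; simpa using hpne
        simp [hf'p] at this
    · intro a
      by_cases ha : a = p
      · subst ha; rw [hf'p]
      · rw [hf' a ha]; exact hfg a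
  · have : f = g := by
      ext p
      by_contra h
      exact hne ⟨p, by simpa using h⟩
    rw [this]

end Homotopy

end ClassifyingSpace

/-! ### Fences of maps and combinatorial contractibility. -/

/-- The equivalence relation on order-preserving maps generated by comparability. -/
def OrderHom.Fenced {P Q : Type*} [PartialOrder P] [PartialOrder Q] : (P →o Q) → (P →o Q) → Prop :=
  Relation.EqvGen (· ≤ ·)

namespace OrderHom.Fenced

variable {P Q R : Type*} [PartialOrder P] [PartialOrder Q] [PartialOrder R]

theorem of_le {f g : P →o Q} (h : f ≤ g) : f.Fenced g := .rel _ _ h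

theorem trans {f g h : P →o Q} (h1 : f.Fenced g) (h2 : g.Fenced h) : f.Fenced h :=
  Relation.EqvGen.trans _ _ _ h1 h2

theorem symm {f g : P →o Q} (h1 : f.Fenced g) : g.Fenced f := Relation.EqvGen.symm _ _ h1

theorem comp_right {f g : P →o Q} (h : f.Fenced g) (k : R →o P) : (f.comp k).Fenced (g.comp k) := by
  induction h with
  | rel f g h => exact .rel _ _ fun p => h (k p)
  | refl f => exact .refl _
  | symm f g _ ih => exact ih.symm
  | trans f g h _ _ ih1 ih2 => exact ih1.trans ih2

theorem comp_left {f g : P →o Q} (h : f.Fenced g) (k : Q →o R) : (k.comp f).Fenced (k.comp g) := by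
  induction h with
  | rel f g h => exact .rel _ _ fun p => k.monotone (h p)
  | refl f => exact .refl _
  | symm f g _ ih => exact ih.symm
  | trans f g h _ _ ih1 ih2 => exact ih1.trans ih2

theorem homotopic [Finite P] [Finite Q] {f g : P →o Q} (h : f.Fenced g) :
    (ClassifyingSpace.map f).Homotopic (ClassifyingSpace.map g) := by
  induction h with
  | rel f g h => exact ClassifyingSpace.homotopic_of_le h
  | refl f => exact .refl _
  | symm f g _ ih => exact ih.symm
  | trans f g h _ _ ih1 ih2 => exact ih1.trans ih2

end OrderHom.Fenced

/-- A poset is order contractible if its identity can be joined to a constant map by a fence of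
order-preserving maps. -/
def OrderContractible (P : Type*) [PartialOrder P] : Prop :=
  ∃ c : P, (OrderHom.id : P →o P).Fenced (OrderHom.const P c)

theorem OrderContractible.of_orderIso {P Q : Type*} [PartialOrder P] [PartialOrder Q] (e : P ≃o Q)
    (h : OrderContractible P) : OrderContractible Q := by
  obtain ⟨c, hc⟩ := h
  refine ⟨e c, ?_⟩
  have := (hc.comp_right (e.symm : Q →o P)).comp_left (e : P →o Q)
  have e1 : (e : P →o Q).comp (OrderHom.id.comp (e.symm : Q →o P)) = OrderHom.id := by
    ext q; simp
  rwa [e1] at this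

namespace IsPosetHomotopyEquiv

open ClassifyingSpace

variable {P Q R : Type*} [PartialOrder P] [PartialOrder Q] [PartialOrder R]
  [Finite P] [Finite Q] [Finite R]

theorem of_inverse {f : P →o Q} (g : C(ClassifyingSpace Q, ClassifyingSpace P))
    (h1 : (g.comp (ClassifyingSpace.map f)).Homotopic (ContinuousMap.id _))
    (h2 : ((ClassifyingSpace.map f).comp g).Homotopic (ContinuousMap.id _)) :
    IsPosetHomotopyEquiv f :=
  ⟨⟨ClassifyingSpace.map f, g, h1, h2⟩, fun _ => rfl⟩

theorem exists_inverse {f : P →o Q} (hf : IsPosetHomotopyEquiv f) :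
    ∃ g : C(ClassifyingSpace Q, ClassifyingSpace P),
      (g.comp (ClassifyingSpace.map f)).Homotopic (ContinuousMap.id _) ∧
      ((ClassifyingSpace.map f).comp g).Homotopic (ContinuousMap.id _) := by
  obtain ⟨h, hh⟩ := hf
  have : h.toFun = ClassifyingSpace.map f := ContinuousMap.ext hh
  exact ⟨h.invFun, this ▸ h.left_inv, this ▸ h.right_inv⟩

theorem comp {g : Q →o R} {f : P →o Q} (hg : IsPosetHomotopyEquiv g)
    (hf : IsPosetHomotopyEquiv f) : IsPosetHomotopyEquiv (g.comp f) := by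
  obtain ⟨h, hh⟩ := hg
  obtain ⟨k, hk⟩ := hf
  refine ⟨k.trans h, fun x => ?_⟩
  change h (k x) = ClassifyingSpace.map (g.comp f) x
  rw [hh, hk, map_comp]
  rfl

/-- One half of the two-out-of-three property. -/
theorem of_comp_left {g : Q →o R} {f : P →o Q} (hg : IsPosetHomotopyEquiv g)
    (hgf : IsPosetHomotopyEquiv (g.comp f)) : IsPosetHomotopyEquiv f := by
  obtain ⟨g', hg1, hg2⟩ := hg.exists_inverse
  obtain ⟨k, hk1, hk2⟩ := hgf.exists_inverse
  rw [map_comp] at hk1 hk2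
  refine of_inverse (k.comp (ClassifyingSpace.map g)) hk1 ?_
  have e1 := (ContinuousMap.Homotopic.comp (.refl g') hk2).comp (.refl (ClassifyingSpace.map g))
  have e2 := ContinuousMap.Homotopic.comp hg1
    (.refl ((ClassifyingSpace.map f).comp (k.comp (ClassifyingSpace.map g))))
  exact e2.symm.trans (e1.trans hg1)

theorem of_fenced_inverse {f : P →o Q} (g : Q →o P) (h1 : (g.comp f).Fenced OrderHom.id)
    (h2 : (f.comp g).Fenced OrderHom.id) : IsPosetHomotopyEquiv f := by
  refine of_inverse (ClassifyingSpace.map g) ?_ ?_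
  · rw [← map_comp, ← map_id]; exact h1.homotopic
  · rw [← map_comp, ← map_id]; exact h2.homotopic

end IsPosetHomotopyEquiv

namespace ClassifyingSpace

open Topology unitInterval

/-! ### Removing a point whose strict lower set is contractible. -/

section RemovePoint

theorem sum_split_lt {R : Type*} [PartialOrder R] [Fintype R] [DecidableEq R]
    [DecidableLT R] (q : R) (g : R → ℝ) :
    ∑ r, g r = g q + ((∑ r : {r // r < q}, g r) +
      ∑ r ∈ Finset.univ.filter fun r => ¬ r < q ∧ r ≠ q, g r) := by
  have h1 := Finset.sum_filter_add_sum_filter_not Finset.univ (fun r => r < q) g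
  have h2 : ∑ r ∈ Finset.univ.filter (fun r => r < q), g r = ∑ r : {r // r < q}, g r :=
    Finset.sum_subtype _ (by simp) _
  have h3 : Finset.univ.filter (fun r => ¬ r < q) =
      insert q (Finset.univ.filter fun r => ¬ r < q ∧ r ≠ q) := by
    ext r
    by_cases h : r = q <;> simp [h]
  rw [h2, h3, Finset.sum_insert (by simp)] at h1
  rw [← h1]
  ring

variable {P R : Type*} [PartialOrder P] [PartialOrder R] [Finite P] [Finite R]

/-- `N` may jump where `m` vanishes, but the product does not see it. Where `m = 0 < a` the ratio
equals `2`, so the clamped time is `1` on a whole neighbourhood and `K (1, ·)` is constant; with `a`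
in place of `2 * a` the ratio would only reach the borderline `1`. Where `m + a = 0` the prefactor
tends to `0` and the coordinates stay bounded by `1`. -/
theorem continuous_mul_contraction {Z : Type*} [TopologicalSpace Z] {N : Z → ClassifyingSpace P}
    {m a : Z → ℝ} (hm : Continuous m) (ha : Continuous a) (hm0 : ∀ z, 0 ≤ m z)
    (ha0 : ∀ z, 0 ≤ a z) (hN : ∀ z, m z ≠ 0 → ContinuousAt N z)
    {K : I × ClassifyingSpace P → ClassifyingSpace P} (hK : Continuous K) {c : ClassifyingSpace P}
    (hK1 : ∀ y, K (1, y) = c) (p : P) :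
    Continuous fun z =>
      (m z + a z) * K (Set.projIcc 0 1 zero_le_one (2 * a z / (m z + a z)), N z) p := by
  have hma : Continuous fun z => m z + a z := hm.add ha
  refine continuous_iff_continuousAt.2 fun z => ?_
  by_cases h0 : m z + a z = 0
  · have h1 : Filter.Tendsto (fun z => m z + a z) (𝓝 z) (𝓝 0) := by
      have := hma.tendsto z
      rwa [h0] at this
    rw [ContinuousAt, h0, zero_mul]
    refine squeeze_zero (fun w => mul_nonneg (add_nonneg (hm0 w) (ha0 w)) (nonneg _ _))
      (fun w => ?_) h1
    exact mul_le_of_le_one_right (add_nonneg (hm0 w) (ha0 w)) (le_one _ _)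
  · by_cases hmz : m z = 0
    · have h2 : 2 * a z / (m z + a z) = 2 := by
        rw [hmz, zero_add] at h0 ⊢
        field_simp
      have hc : ContinuousAt (fun z => 2 * a z / (m z + a z)) z :=
        (continuous_const.mul ha).continuousAt.div hma.continuousAt h0
      have hev : ∀ᶠ w in 𝓝 z, 1 < 2 * a w / (m w + a w) :=
        hc.eventually_const_lt (by change 1 < 2 * a z / (m z + a z); rw [h2]; norm_num)
      have : ContinuousAt (fun w => (m w + a w) * c p) z := (hma.mul continuous_const).continuousAt
      refine this.congr ?_
      filter_upwards [hev] with w hw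
      rw [Set.projIcc_of_right_le _ hw.le]
      congr 2
      exact (hK1 _).symm
    · refine hma.continuousAt.mul ?_
      refine (continuous_eval p).continuousAt.comp (hK.continuousAt.comp ?_)
      refine ContinuousAt.prodMk (continuous_projIcc.continuousAt.comp ?_) (hN z hmz)
      exact (continuous_const.mul ha).continuousAt.div hma.continuousAt h0

/-- The total weight of a point of `|R|` below `q`. -/
noncomputable def weightBelow (q : R) (x : ClassifyingSpace R) : ℝ :=
  letI := Fintype.ofFinite {r // r < q}
  ∑ r : {r // r < q}, x r

theorem weightBelow_eq [Fintype R] [DecidableLT R] (q : R) (x : ClassifyingSpace R) :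
    weightBelow q x = ∑ r : {r // r < q}, x r := by
  unfold weightBelow
  congr!

theorem weightBelow_nonneg (q : R) (x : ClassifyingSpace R) : 0 ≤ weightBelow q x :=
  Finset.sum_nonneg fun _ _ => x.nonneg _

theorem continuous_weightBelow (q : R) : Continuous (weightBelow q) :=
  continuous_finsetSum _ fun _ _ => continuous_eval _

theorem eq_zero_of_weightBelow_eq_zero {q : R} {x : ClassifyingSpace R} (h : weightBelow q x = 0)
    {r : R} (hr : r < q) : x r = 0 := by
  let _ := Fintype.ofFinite {r // r < q}
  exact (Finset.sum_eq_zero_iff_of_nonneg fun _ _ => x.nonneg _).1 h ⟨r, hr⟩ (Finset.mem_univ _)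

open Classical in
/-- The part of a point of `|R|` below `q`, normalized to a point of `|R_{<q}|`. -/
noncomputable def normBelow (q : R) (c : ClassifyingSpace {r // r < q}) (x : ClassifyingSpace R) :
    ClassifyingSpace {r // r < q} :=
  letI := Fintype.ofFinite {r // r < q}
  -- Any point would serve at weight zero: in `pushCoord` the result is then multiplied by `0` or
  -- fed to the end of `K`, where the contraction is constant.
  if h : weightBelow q x = 0 then c else
    mk (fun r => x r / weightBelow q x)
      (fun r => div_nonneg (x.nonneg _) (weightBelow_nonneg q x))
      (by rw [← Finset.sum_div]; exact div_self h)
      (fun r s hr hs => x.comparable (left_ne_zero_of_mul hr) (left_ne_zero_of_mul hs))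

theorem normBelow_apply {q : R} {c : ClassifyingSpace {r // r < q}} {x : ClassifyingSpace R}
    (h : weightBelow q x ≠ 0) (r : {r // r < q}) :
    normBelow q c x r = x r / weightBelow q x := by
  rw [normBelow, dif_neg h]
  rfl

theorem weightBelow_mul_normBelow (q : R) (c : ClassifyingSpace {r // r < q})
    (x : ClassifyingSpace R) (r : {r // r < q}) :
    weightBelow q x * normBelow q c x r = x r := by
  by_cases h : weightBelow q x = 0
  · rw [h, zero_mul, eq_zero_of_weightBelow_eq_zero h r.2]
  · rw [normBelow_apply h]
    field_simp

theorem continuousAt_normBelow (q : R) (c : ClassifyingSpace {r // r < q})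
    (x : ClassifyingSpace R) (h : weightBelow q x ≠ 0) : ContinuousAt (normBelow q c) x := by
  have hind : IsInducing fun y : ClassifyingSpace {r // r < q} => (y : {r // r < q} → ℝ) := ⟨rfl⟩
  rw [hind.continuousAt_iff, continuousAt_pi]
  intro r
  have h1 : ContinuousAt (fun x : ClassifyingSpace R => x r / weightBelow q x) x :=
    (continuous_eval _).continuousAt.div (continuous_weightBelow q).continuousAt h
  refine h1.congr ?_
  filter_upwards [(continuous_weightBelow q).continuousAt.eventually_ne h] with y hy
  exact (normBelow_apply hy r).symm

/-- The coordinates of the deformation of `|R|` which moves the weight of `q` into `|R_{<q}|`,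
along a contraction `K` of the latter. -/
noncomputable def pushCoord (q : R) [DecidableEq R] [DecidableLT R]
    (K : I × ClassifyingSpace {r // r < q} → ClassifyingSpace {r // r < q})
    (c : ClassifyingSpace {r // r < q}) (z : I × ClassifyingSpace R) (r : R) : ℝ :=
  if r = q then (1 - (z.1 : ℝ)) * z.2 q else
    if h : r < q then (weightBelow q z.2 + z.1 * z.2 q) *
      K (Set.projIcc 0 1 zero_le_one (2 * (z.1 * z.2 q) / (weightBelow q z.2 + z.1 * z.2 q)),
        normBelow q c z.2) ⟨r, h⟩
    else z.2 r

section

variable (q : R) [DecidableEq R] [DecidableLT R]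
    {K : I × ClassifyingSpace {r // r < q} → ClassifyingSpace {r // r < q}}
    (c : ClassifyingSpace {r // r < q})

/-- Covers both time `0` and points carrying no weight at `q`. The quotient inside `K` is then `0`,
even when its denominator vanishes. -/
theorem pushCoord_eq_self (hK0 : ∀ y, K (0, y) = y) (z : I × ClassifyingSpace R)
    (hz : (z.1 : ℝ) * z.2 q = 0) (r : R) : pushCoord q K c z r = z.2 r := by
  unfold pushCoord
  split_ifs with h1 h2
  · rw [h1, sub_mul, one_mul, hz, sub_zero]
  · rw [hz, mul_zero, zero_div, add_zero, Set.projIcc_left]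
    change _ * (K (0, _)) _ = _
    rw [hK0, weightBelow_mul_normBelow]
  · rfl

theorem pushCoord_nonneg (z : I × ClassifyingSpace R) (r : R) : 0 ≤ pushCoord q K c z r := by
  unfold pushCoord
  split_ifs
  · exact mul_nonneg (sub_nonneg.2 z.1.2.2) (nonneg _ _)
  · exact mul_nonneg (add_nonneg (weightBelow_nonneg _ _) (mul_nonneg z.1.2.1 (nonneg _ _)))
      (nonneg _ _)
  · exact nonneg _ _

theorem sum_pushCoord [Fintype R] (z : I × ClassifyingSpace R) :
    ∑ r, pushCoord q K c z r = 1 := by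
  rw [← z.2.sum_eq_one, sum_split_lt q, sum_split_lt q z.2.coord, ← weightBelow_eq]
  have h1 : ∑ r : {r // r < q}, pushCoord q K c z r = weightBelow q z.2 + z.1 * z.2 q := by
    have : ∀ r : {r // r < q}, pushCoord q K c z r = (weightBelow q z.2 + z.1 * z.2 q) *
      K (Set.projIcc 0 1 zero_le_one (2 * (z.1 * z.2 q) / (weightBelow q z.2 + z.1 * z.2 q)),
        normBelow q c z.2) r := by
      intro r
      rw [pushCoord, if_neg r.2.ne, dif_pos r.2]
    rw [Finset.sum_congr rfl fun r _ => this r, ← Finset.mul_sum, sum_eq_one, mul_one]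
  have h2 : ∑ r ∈ Finset.univ.filter (fun r => ¬ r < q ∧ r ≠ q), pushCoord q K c z r =
      ∑ r ∈ Finset.univ.filter (fun r => ¬ r < q ∧ r ≠ q), z.2 r := by
    refine Finset.sum_congr rfl fun r hr => ?_
    have hr' : ¬ r < q ∧ r ≠ q := by simpa using hr
    rw [pushCoord, if_neg hr'.2, dif_neg hr'.1]
  rw [h1, h2, pushCoord, if_pos rfl]
  ring

/-- If `q` carries weight, the old support is comparable with `q`, so what remains outside `R_{<q}`
is `q` or lies above it. The part below `q` is supported on the support of one point of `|R_{<q}|`,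
again a chain. -/
theorem pushCoord_comparable (hK0 : ∀ y, K (0, y) = y) (z : I × ClassifyingSpace R) {r s : R}
    (hr : pushCoord q K c z r ≠ 0) (hs : pushCoord q K c z s ≠ 0) : r ≤ s ∨ s ≤ r := by
  by_cases hz : z.2 q = 0
  · rw [pushCoord_eq_self q c hK0 z (by rw [hz, mul_zero])] at hr hs
    exact z.2.comparable hr hs
  · have key : ∀ r, pushCoord q K c z r ≠ 0 → r = q ∨ q < r ∨ ∃ h : r < q,
        K (Set.projIcc 0 1 zero_le_one (2 * (z.1 * z.2 q) / (weightBelow q z.2 + z.1 * z.2 q)),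
        normBelow q c z.2) ⟨r, h⟩ ≠ 0 := by
      intro r hr
      by_cases h1 : r = q
      · exact Or.inl h1
      · by_cases h2 : r < q
        · rw [pushCoord, if_neg h1, dif_pos h2] at hr
          exact Or.inr (Or.inr ⟨h2, right_ne_zero_of_mul hr⟩)
        · rw [pushCoord, if_neg h1, dif_neg h2] at hr
          rcases z.2.comparable hr hz with h | h
          · exact absurd (lt_of_le_of_ne h h1) h2
          · exact Or.inr (Or.inl (lt_of_le_of_ne h (Ne.symm h1)))
    rcases key r hr with rfl | hr | ⟨hr, hr'⟩ <;> rcases key s hs with rfl | hs | ⟨hs, hs'⟩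
    · exact Or.inl le_rfl
    · exact Or.inl hs.le
    · exact Or.inr hs.le
    · exact Or.inr hr.le
    · have hr' : z.2 r ≠ 0 := by
        rwa [pushCoord, if_neg hr.ne', dif_neg hr.not_gt] at *
      have hs' : z.2 s ≠ 0 := by
        rwa [pushCoord, if_neg hs.ne', dif_neg hs.not_gt] at *
      exact z.2.comparable hr' hs'
    · exact Or.inr (hs.trans hr).le
    · exact Or.inl hr.le
    · exact Or.inl (hr.trans hs).le
    · exact (comparable _ hr' hs' : (⟨r, hr⟩ : {r // r < q}) ≤ ⟨s, hs⟩ ∨ _)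

theorem continuous_pushCoord (hK : Continuous K) (hK1 : ∀ y, K (1, y) = c) (r : R) :
    Continuous fun z => pushCoord q K c z r := by
  have h3 : Continuous fun z : I × ClassifyingSpace R => (z.1 : ℝ) :=
    continuous_subtype_val.comp continuous_fst
  have h4 : Continuous fun z : I × ClassifyingSpace R => z.2 q :=
    (continuous_eval q).comp continuous_snd
  unfold pushCoord
  split_ifs with h1 h2
  · exact (continuous_const.sub h3).mul h4
  · exact continuous_mul_contraction (N := fun z : I × ClassifyingSpace R => normBelow q c z.2)
      ((continuous_weightBelow q).comp continuous_snd) (h3.mul h4)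
      (fun z => weightBelow_nonneg _ _) (fun z => mul_nonneg z.1.2.1 (nonneg _ _))
      (fun z hz => (continuousAt_normBelow q c z.2 hz).comp continuous_snd.continuousAt)
      hK hK1 ⟨r, h2⟩
  · exact (continuous_eval r).comp continuous_snd

end

theorem map_apply_of_embedding (i : P ↪o R) (x : ClassifyingSpace P) (p : P) :
    map (i : P →o R) x (i p) = x p :=
  Finsupp.mapDomain_apply i.injective x.1 p

/-- Removing a point `q` such that `R_{<q}` is contractible does not change the homotopy type. -/
theorem isPosetHomotopyEquiv_of_range_eq_compl (i : P ↪o R) (q : R) (hq : Set.range i = {q}ᶜ)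
    (hL : OrderContractible {r // r < q}) : IsPosetHomotopyEquiv (i : P →o R) := by
  classical
  have := Fintype.ofFinite P
  have := Fintype.ofFinite R
  obtain ⟨c₀, hc⟩ := hL
  obtain ⟨K⟩ := hc.homotopic
  set c := vertex c₀
  have hK0 : ∀ y, K (0, y) = y := fun y => by rw [K.apply_zero, map_id]; rfl
  have hK1 : ∀ y, K (1, y) = c := fun y => by rw [K.apply_one, map_const]
  have hiq : ∀ p, i p ≠ q := fun p => by
    have : i p ∈ ({q}ᶜ : Set R) := hq ▸ Set.mem_range_self p
    exact this
  have hex : ∀ r, r ≠ q → ∃ p, i p = r := fun r hr => by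
    have : r ∈ Set.range i := by rw [hq]; exact hr
    exact this
  let H : C(I × ClassifyingSpace R, ClassifyingSpace R) :=
    ⟨fun z => mk (pushCoord q K c z) (pushCoord_nonneg q c z) (sum_pushCoord q c z)
      (fun _ _ => pushCoord_comparable q c hK0 z),
      continuous_iff.2 fun r => continuous_pushCoord q c K.continuous hK1 r⟩
  have hH : ∀ z r, H z r = pushCoord q K c z r := fun _ _ => rfl
  have hHq : ∀ x, H (1, x) q = 0 := fun x => by
    rw [hH, pushCoord, if_pos rfl]
    simp
  -- At time `1` all weight has left `q`, so the end of the deformation is a retraction onto `|P|`.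
  let ρ : C(ClassifyingSpace R, ClassifyingSpace P) :=
    ⟨fun x => mk (fun p => H (1, x) (i p)) (fun _ => nonneg _ _)
      (by
        rw [← (H (1, x)).sum_eq_one]
        refine Fintype.sum_of_injective i i.injective _ _ (fun r hr => ?_) fun _ => rfl
        have : r = q := by simpa [hq] using hr
        rw [this, hHq])
      (fun p p' hp hp' => by
        simpa using (H (1, x)).comparable hp hp'),
      continuous_iff.2 fun p => (continuous_eval (i p)).comp
        (H.continuous.comp (Continuous.prodMk_right 1))⟩
  have hmapq : ∀ y : ClassifyingSpace P, map (i : P →o R) y q = 0 := fun y => by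
    by_contra h
    obtain ⟨p, hp, -⟩ := mapFun_ne_zero h
    exact hiq p hp
  refine IsPosetHomotopyEquiv.of_inverse ρ ?_ ?_
  · have : ρ.comp (map (i : P →o R)) = ContinuousMap.id _ := by
      ext y p
      change pushCoord q K c (1, map (i : P →o R) y) (i p) = y p
      rw [pushCoord_eq_self q c hK0 _ (by simp [hmapq]), map_apply_of_embedding]
    rw [this]
  · refine ContinuousMap.Homotopic.symm ⟨⟨H, fun x => ?_, fun x => ?_⟩⟩
    · ext r
      change pushCoord q K c (0, x) r = x r
      rw [pushCoord_eq_self q c hK0 _ (by simp)]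
    · ext r
      by_cases hr : r = q
      · rw [hr]
        change H (1, x) q = map (i : P →o R) (ρ x) q
        rw [hHq, hmapq]
      · obtain ⟨p, rfl⟩ := hex r hr
        change H (1, x) (i p) = map (i : P →o R) (ρ x) (i p)
        rw [map_apply_of_embedding]
        rfl

end RemovePoint

end ClassifyingSpace

/-! ### Quillen's fiber lemma. -/

namespace IsPosetHomotopyEquiv

variable {P Q : Type*} [PartialOrder P] [PartialOrder Q] [Finite P] [Finite Q]

theorem of_orderIso (e : P ≃o Q) : IsPosetHomotopyEquiv (e : P →o Q) := by
  refine of_fenced_inverse (e.symm : Q →o P) (.of_le fun p => ?_) (.of_le fun p => ?_)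
  · exact (e.symm_apply_apply p).le
  · exact (e.apply_symm_apply p).le

/-- Points outside `A` are added one by one, a maximal one each time. A point added earlier is thus
never below a later one, so the strict lower set of each new point consists of elements of `A` only,
and it is contractible by `hA`. -/
theorem subtype_val (A : Set P) (hA : ∀ q ∉ A, OrderContractible {x : A // (x : P) < q}) :
    IsPosetHomotopyEquiv (OrderHom.Subtype.val (· ∈ A)) := by
  induction hn : Aᶜ.ncard generalizing A with
  | zero =>
    have : A = Set.univ := by
      rw [Set.ncard_eq_zero (Set.toFinite _)] at hn
      exact Set.compl_empty_iff.1 hn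
    subst this
    refine of_fenced_inverse ⟨fun p => ⟨p, trivial⟩, fun _ _ h => h⟩
      (.of_le fun p => le_rfl) (.of_le fun p => le_rfl)
  | succ n ih =>
    have hne : Aᶜ.Nonempty := by
      rw [← Set.ncard_pos (Set.toFinite _)]; omega
    obtain ⟨q, hq⟩ := (Set.toFinite Aᶜ).exists_maximal hne
    have hqA : q ∉ A := hq.prop
    have hmax : ∀ q', q < q' → q' ∈ A := by
      intro q' h
      by_contra h'
      exact h.not_ge (hq.le_of_ge h' h.le)
    let i : A ↪o ↥(insert q A) :=
      ⟨⟨fun a => ⟨a, Or.inr a.2⟩, fun a b h => Subtype.ext (congrArg (fun x => x.1) h)⟩, Iff.rfl⟩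
    have h1 : IsPosetHomotopyEquiv (i : A →o ↥(insert q A)) := by
      refine ClassifyingSpace.isPosetHomotopyEquiv_of_range_eq_compl i ⟨q, Or.inl rfl⟩ ?_ ?_
      · ext ⟨r, hr⟩
        constructor
        · rintro ⟨a, ha⟩ h
          have : (a : P) = q := (congrArg Subtype.val ha).trans (congrArg Subtype.val h)
          exact hqA (this ▸ a.2)
        · intro h
          rcases hr with hr | hr
          · exact absurd (Subtype.ext hr) h
          · exact ⟨⟨r, hr⟩, rfl⟩
      · have hmem : ∀ x : ↥(insert q A), x < ⟨q, Or.inl rfl⟩ → (x : P) ∈ A := fun x hx =>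
          x.2.resolve_left fun h => hx.ne (Subtype.ext h)
        exact (hA q hqA).of_orderIso
          ⟨⟨fun x => ⟨⟨x.1, Or.inr x.1.2⟩, x.2⟩, fun x => ⟨⟨x.1, hmem _ x.2⟩, x.2⟩, fun _ => rfl,
            fun _ => rfl⟩, Iff.rfl⟩
    have h2 : IsPosetHomotopyEquiv (OrderHom.Subtype.val (· ∈ insert q A)) := by
      refine ih (insert q A) (fun q' hq' => ?_) ?_
      · have hq'A : q' ∉ A := fun h => hq' (Or.inr h)
        have hqq' : ¬ q < q' := fun h => hq'A (hmax q' h)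
        have hmem : ∀ x : ↥(insert q A), (x : P) < q' → (x : P) ∈ A := fun x hx =>
          x.2.resolve_left fun h => hqq' (h ▸ hx)
        exact (hA q' hq'A).of_orderIso
          ⟨⟨fun x => ⟨⟨x.1, Or.inr x.1.2⟩, x.2⟩, fun x => ⟨⟨x.1, hmem _ x.2⟩, x.2⟩, fun _ => rfl,
            fun _ => rfl⟩, Iff.rfl⟩
      · have : (insert q A)ᶜ = Aᶜ \ {q} := by
          ext r; simp [not_or, and_comm]
        rw [this, Set.ncard_sdiff_singleton_of_mem hqA, hn]
        rfl
    exact h2.comp h1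

/-- The mapping cylinder of an order-preserving map: the disjoint union of `P` and `Q`, where
`p ≤ q` for `p` in `P` and `q` in `Q` iff `f p ≤ q`. -/
structure Cylinder {P Q : Type*} [PartialOrder P] [PartialOrder Q] (f : P →o Q) where
  val : P ⊕ Q

instance (f : P →o Q) : PartialOrder (Cylinder f) where
  le
    | ⟨.inl a⟩, ⟨.inl b⟩ => a ≤ b
    | ⟨.inl a⟩, ⟨.inr b⟩ => f a ≤ b
    | ⟨.inr _⟩, ⟨.inl _⟩ => False
    | ⟨.inr a⟩, ⟨.inr b⟩ => a ≤ b
  le_refl := by rintro ⟨a | a⟩ <;> exact le_refl a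
  le_trans := by
    rintro ⟨a | a⟩ ⟨b | b⟩ ⟨c | c⟩ hab hbc
    · exact le_trans hab hbc
    · exact le_trans (f.monotone hab) hbc
    · exact hbc.elim
    · exact le_trans hab hbc
    · exact hab.elim
    · exact hab.elim
    · exact hbc.elim
    · exact le_trans hab hbc
  le_antisymm := by
    rintro ⟨a | a⟩ ⟨b | b⟩ hab hba
    · rw [le_antisymm hab hba]
    · exact hba.elim
    · exact hab.elim
    · rw [le_antisymm hab hba]

instance (f : P →o Q) : Finite (Cylinder f) :=
  Finite.of_injective Cylinder.val fun ⟨_⟩ ⟨_⟩ h => congrArg Cylinder.mk h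

/-- Quillen's fiber lemma: a map with contractible fibers `f ⁻¹ (Q_{≤q})` is a homotopy
equivalence. -/
theorem of_fibers (f : P →o Q) (hf : ∀ q, OrderContractible {p // f p ≤ q}) :
    IsPosetHomotopyEquiv f := by
  -- `f` factors as the inclusion into the cylinder followed by the projection to `Q`. The
  -- projection has a fence inverse, and the elements of `P` below `q` in the cylinder form exactly
  -- the fiber over `q`.
  let inl : P →o Cylinder f := ⟨fun p => ⟨.inl p⟩, fun _ _ h => h⟩
  let inr : Q →o Cylinder f := ⟨fun q => ⟨.inr q⟩, fun _ _ h => h⟩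
  let proj : Cylinder f →o Q := ⟨fun z => z.val.elim f id, by
    rintro ⟨a | a⟩ ⟨b | b⟩ h
    · exact f.monotone h
    · exact h
    · exact h.elim
    · exact h⟩
  have h1 : IsPosetHomotopyEquiv proj := by
    refine of_fenced_inverse inr (OrderHom.Fenced.of_le ?_).symm (.of_le fun q => le_rfl)
    rintro ⟨a | a⟩
    · exact le_refl (f a)
    · exact le_refl a
  let A : Set (Cylinder f) := Set.range inl
  let e : P ≃o A :=
    { toFun := fun p => ⟨inl p, p, rfl⟩
      invFun := fun z => z.2.choose
      left_inv := fun p => by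
        have := (⟨p, rfl⟩ : ∃ p', inl p' = inl p).choose_spec
        exact Sum.inl_injective (congrArg Cylinder.val this)
      right_inv := fun z => Subtype.ext z.2.choose_spec
      map_rel_iff' := Iff.rfl }
  have h2 : IsPosetHomotopyEquiv (OrderHom.Subtype.val (· ∈ A)) := by
    refine subtype_val A ?_
    rintro ⟨p | q⟩ hq
    · exact absurd ⟨p, rfl⟩ hq
    · have hlt : ∀ p, inl p < inr q ↔ f p ≤ q := fun p =>
        ⟨fun h => h.le, fun h => lt_of_le_not_ge h fun h' => h'.elim⟩
      have hinv : ∀ z : A, (z : Cylinder f) < inr q → f (e.symm z) ≤ q := fun z hz => by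
        have h3 : inl (e.symm z) = z.1 := congrArg Subtype.val (e.apply_symm_apply z)
        rwa [← hlt, h3]
      let e' : {p // f p ≤ q} ≃o {x : A // (x : Cylinder f) < inr q} :=
        { toFun := fun p => ⟨e p.1, (hlt _).2 p.2⟩
          invFun := fun z => ⟨e.symm z.1, hinv _ z.2⟩
          left_inv := fun p => Subtype.ext (e.symm_apply_apply _)
          right_inv := fun z => Subtype.ext (e.apply_symm_apply _)
          map_rel_iff' := Iff.rfl }
      exact (hf q).of_orderIso e'
  exact (h1.comp (h2.comp (of_orderIso e)) :)

end IsPosetHomotopyEquiv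

/-! ## Graphs without short cycles -/

namespace SimpleGraph

variable {V W : Type*}

/-- Every subgraph with at most `k` edges is a forest. -/
def ForestUpTo (S : SimpleGraph V) (k : ℕ) : Prop :=
  ∀ H ≤ S, H.edgeSet.encard ≤ k → H.IsAcyclic

theorem Walk.IsTrail.length_le_encard {H : SimpleGraph V} {u v : V} {p : H.Walk u v}
    (hp : p.IsTrail) : (p.length : ℕ∞) ≤ H.edgeSet.encard := by
  classical
  have h1 : p.edges.toFinset.card = p.length := by
    rw [List.toFinset_card_of_nodup hp.edges_nodup, Walk.length_edges]
  rw [← h1, ← Set.encard_coe_eq_coe_finsetCard]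
  refine Set.encard_le_encard fun e he => ?_
  exact p.edges_subset_edgeSet (by simpa using he)

/-- A cycle has as many edges as its length, so it does not fit into a subgraph with at most `k`
edges. The gain over the girth is that `ForestUpTo` is easy to transfer to `X_e` by taking images of
edge sets. -/
theorem ForestUpTo.of_lt_egirth {S : SimpleGraph V} {k : ℕ} (h : (k : ℕ∞) < S.egirth) :
    S.ForestUpTo k := by
  intro H hH hk u p hp
  have h1 := egirth_le_length (hp.mapLe hH)
  have h2 : (p.mapLe hH).length = p.length := by simp
  rw [h2] at h1
  exact absurd (h1.trans (hp.isTrail.length_le_encard.trans hk)) (not_le.2 h)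

/-- A geodesic to `z` that met `u` before its end would make `u` strictly closer to `c` than `z`. -/
theorem Walk.notMem_support_of_dist_le {S : SimpleGraph V} {c u z : V} (p : S.Walk c z)
    (hp : p.length = S.dist c z) (hu : u ≠ z) (hd : S.dist c z ≤ S.dist c u) : u ∉ p.support := by
  classical
  intro hmem
  have h1 := p.length_takeUntil_lt_length hmem hu
  have h2 := dist_le (p.takeUntil u hmem)
  omega

/-- In a graph without short cycles, the neighbour of `u` towards `c` is unique. -/
theorem ForestUpTo.eq_of_dist_le {S : SimpleGraph V} {k : ℕ} (hS : S.ForestUpTo k) {c u z z' : V}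
    (hcu : S.Reachable c u) (hk : 2 * S.dist c u + 2 ≤ k) (hz : S.Adj z u) (hz' : S.Adj z' u)
    (hd : S.dist c z ≤ S.dist c u) (hd' : S.dist c z' ≤ S.dist c u) : z = z' := by
  classical
  obtain ⟨p, hp⟩ := (hcu.trans hz.symm.reachable).exists_walk_length_eq_dist
  obtain ⟨p', hp'⟩ := (hcu.trans hz'.symm.reachable).exists_walk_length_eq_dist
  -- Two geodesics, each prolonged by one edge, give paths from `c` to `u`. Together they have at
  -- most `2 * dist c u + 2` edges, so their union is a forest, the paths coincide, and so do their
  -- penultimate vertices.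
  have hP : (p.concat hz).IsPath := (p.isPath_of_length_eq_dist hp).concat
    (p.notMem_support_of_dist_le hp hz.ne' hd) hz
  have hP' : (p'.concat hz').IsPath := (p'.isPath_of_length_eq_dist hp').concat
    (p'.notMem_support_of_dist_le hp' hz'.ne' hd') hz'
  set E : Finset (Sym2 V) := (p.concat hz).edges.toFinset ∪ (p'.concat hz').edges.toFinset with hE
  have hES : (E : Set (Sym2 V)) ⊆ S.edgeSet := by
    intro e he
    simp only [hE, Finset.coe_union, List.coe_toFinset, Set.mem_union, Set.mem_ofPred_eq] at he
    rcases he with he | he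
    · exact Walk.edges_subset_edgeSet _ he
    · exact Walk.edges_subset_edgeSet _ he
  set H := fromEdgeSet (E : Set (Sym2 V)) with hH
  have hHE : H.edgeSet = E := by
    rw [hH, edgeSet_fromEdgeSet]
    ext e
    simp only [Set.mem_sdiff, and_iff_left_iff_imp]
    intro he hde
    exact S.not_isDiag_of_mem_edgeSet (hES he) hde
  have hac : H.IsAcyclic := by
    refine hS H ?_ ?_
    · rw [← edgeSet_subset_edgeSet, hHE]
      exact hES
    · rw [hHE, Set.encard_coe_eq_coe_finsetCard]
      have h1 := List.toFinset_card_le (p.concat hz).edges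
      have h2 := List.toFinset_card_le (p'.concat hz').edges
      have h3 := Finset.card_union_le (p.concat hz).edges.toFinset (p'.concat hz').edges.toFinset
      rw [Walk.length_edges, Walk.length_concat] at h1
      rw [Walk.length_edges, Walk.length_concat] at h2
      rw [← hE] at h3
      exact_mod_cast (by omega : E.card ≤ k)
  have hpe : ∀ e ∈ (p.concat hz).edges, e ∈ H.edgeSet := by
    intro e he
    rw [hHE]
    simp only [hE, Finset.coe_union, List.coe_toFinset, Set.mem_union, Set.mem_ofPred_eq]
    exact Or.inl he
  have hpe' : ∀ e ∈ (p'.concat hz').edges, e ∈ H.edgeSet := by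
    intro e he
    rw [hHE]
    simp only [hE, Finset.coe_union, List.coe_toFinset, Set.mem_union, Set.mem_ofPred_eq]
    exact Or.inr he
  have heq := (hac.subsingleton_path c u).elim ⟨_, hP.transfer hpe⟩ ⟨_, hP'.transfer hpe'⟩
  have heq' : ((p.concat hz).transfer H hpe).support = ((p'.concat hz').transfer H hpe').support :=
    congrArg (fun q : H.Path c u => q.1.support) heq
  rw [Walk.support_transfer, Walk.support_transfer, Walk.support_concat, Walk.support_concat] at heq'
  have h5 : p.support = p'.support := by simpa using heq'
  have h6 : p.support.getLast p.support_ne_nil = p'.support.getLast p'.support_ne_nil := by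
    simp only [h5]
  simpa using h6

theorem Reachable.exists_adj_dist_lt {S : SimpleGraph V} {c u : V} (h : S.Reachable c u)
    (hne : u ≠ c) : ∃ z, S.Adj z u ∧ S.dist c z < S.dist c u := by
  obtain ⟨p, hp⟩ := h.symm.exists_walk_length_eq_dist
  cases p with
  | nil => exact absurd rfl hne
  | @cons _ z _ hz p =>
    refine ⟨z, hz.symm, ?_⟩
    have := dist_le p
    rw [Walk.length_cons] at hp
    rw [dist_comm, dist_comm (u := c)]
    omega

theorem Reachable.of_map {H : SimpleGraph V} {H' : SimpleGraph W} (φ : V → W)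
    (h : ∀ a b, H.Adj a b → H'.Reachable (φ a) (φ b)) {a b : V} (hab : H.Reachable a b) :
    H'.Reachable (φ a) (φ b) := by
  obtain ⟨p⟩ := hab
  induction p with
  | nil => rfl
  | cons hadj _ ih => exact (h _ _ hadj).trans ih

end SimpleGraph

/-! ### Subdividing an edge creates no short cycle. -/

namespace LoopGraph

variable {V W : Type*}

theorem toSimple_adj_of_no_loop {G : LoopGraph W} (hG : ∀ a, ¬ G.Adj a a) {a b : W} :
    G.toSimple.Adj a b ↔ G.Adj a b :=
  ⟨fun h => h.2, fun h => ⟨fun hab => hG a (by rwa [← hab] at h), h⟩⟩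

theorem no_loop_of_lt_girth {G : LoopGraph W} {k : ℕ} (hk : 1 ≤ k) (h : (k : ℕ∞) < G.girth) :
    (∀ a, ¬ G.Adj a a) ∧ (k : ℕ∞) < G.toSimple.egirth := by
  unfold girth at h
  split_ifs at h with hl
  · exact absurd h (not_lt.2 (by exact_mod_cast hk))
  · exact ⟨fun a ha => hl ⟨a, ha⟩, h⟩

/-- The end of the edge `⟨v, w⟩` to which a new vertex of `G_e` is attached. -/
def edgeEnd (v w : W) (k : Fin 2) : W := ![v, w] k

theorem mk_edgeEnd (v w : W) (k : Fin 2) : s(edgeEnd v w k, edgeEnd v w (1 - k)) = s(v, w) := by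
  fin_cases k
  · rfl
  · exact Sym2.eq_swap

theorem subdivideEdge_adj_inl_inr {G : LoopGraph W} {v w a : W} {k : Fin 2} :
    (G.subdivideEdge v w).Adj (.inl a) (.inr k) ↔ a = edgeEnd v w k := by
  change ((a = v ∧ k = 0) ∨ (a = w ∧ k = 1)) ↔ _
  fin_cases k <;> simp [edgeEnd]

theorem subdivideEdge_adj_inr_inl {G : LoopGraph W} {v w a : W} {k : Fin 2} :
    (G.subdivideEdge v w).Adj (.inr k) (.inl a) ↔ a = edgeEnd v w k :=
  subdivideEdge_adj_inl_inr (G := G)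

theorem subdivideEdgeHom_inl {G : LoopGraph W} {v w a : W} (e : G.Adj v w) :
    G.subdivideEdgeHom e (.inl a) = a := rfl

theorem subdivideEdgeHom_inr {G : LoopGraph W} {v w : W} (e : G.Adj v w) (k : Fin 2) :
    G.subdivideEdgeHom e (.inr k) = edgeEnd v w (1 - k) := by
  fin_cases k <;> rfl

theorem subdivideEdge_no_loop {G : LoopGraph W} {v w : W} (hG : ∀ a, ¬ G.Adj a a) :
    ∀ a, ¬ (G.subdivideEdge v w).Adj a a := by
  rintro (a | i) h
  · exact hG a h.1
  · exact h rfl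

/-- The image `H'` of `H` under `r_e` has no more edges than `H`, hence is a forest. If an edge of
`H` were not a bridge, a detour around it would map to a detour around an edge of `H'`. For an old
edge the map `r_e` does this; but `r_e` sends all three new edges to `e`, so for a new edge a vertex
map collapsing the other two is used instead. -/
theorem forestUpTo_subdivideEdge {G : LoopGraph W} (hl : ∀ a, ¬ G.Adj a a) {v w : W}
    (e : G.Adj v w) {k : ℕ} (hG : G.toSimple.ForestUpTo k) :
    (G.subdivideEdge v w).toSimple.ForestUpTo k := by
  classical
  intro H hH hk
  have hHadj : ∀ {a b}, H.Adj a b → (G.subdivideEdge v w).Adj a b := fun h => (hH h).2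
  set r := G.subdivideEdgeHom e with hr
  set H' := SimpleGraph.fromEdgeSet (Sym2.map r '' H.edgeSet) with hH'
  have hne : ∀ {a b}, H.Adj a b → r a ≠ r b := fun {a b} h hab =>
    hl (r a) (by
      have := r.map_rel (hHadj h)
      rwa [← hab] at this)
  have hmap : ∀ {a b}, H.Adj a b → H'.Adj (r a) (r b) := fun {a b} h => by
    rw [hH', SimpleGraph.fromEdgeSet_adj]
    exact ⟨⟨s(a, b), h, rfl⟩, hne h⟩
  have hac : H'.IsAcyclic := by
    refine hG H' ?_ ?_
    · intro a b hab
      rw [hH', SimpleGraph.fromEdgeSet_adj] at hab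
      obtain ⟨⟨f, hf, hfab⟩, hab⟩ := hab
      refine ⟨hab, ?_⟩
      induction f with | _ x y =>
      have hxy := r.map_rel (hHadj hf)
      rw [Sym2.map_mk, Sym2.eq_iff] at hfab
      rcases hfab with ⟨h1, h2⟩ | ⟨h1, h2⟩
      · rw [← h1, ← h2]; exact hxy
      · rw [← h1, ← h2]; exact G.symm _ _ hxy
    · refine le_trans ?_ ((Set.encard_image_le (Sym2.map r) _).trans hk)
      rw [hH', SimpleGraph.edgeSet_fromEdgeSet]
      exact Set.encard_le_encard Set.sdiff_subset
  have hvw : ∀ {a b}, H.Adj (.inl a) (.inl b) → s(a, b) ≠ s(v, w) := fun h => (hHadj h).2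
  rw [SimpleGraph.isAcyclic_iff_forall_adj_isBridge] at hac ⊢
  intro x y hxy
  rw [SimpleGraph.isBridge_iff]
  intro hreach
  have hbr := SimpleGraph.isBridge_iff.1 (hac (hmap hxy))
  have key : ∀ φ : W ⊕ Fin 2 → W, s(φ x, φ y) = s(r x, r y) →
      (∀ a b, H.Adj a b → s(a, b) ≠ s(x, y) → φ a = φ b ∨
        H'.Adj (φ a) (φ b) ∧ s(φ a, φ b) ≠ s(r x, r y)) → False := by
    intro φ hφ hφ2
    have h1 : (H'.deleteEdges {s(r x, r y)}).Reachable (φ x) (φ y) := by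
      refine SimpleGraph.Reachable.of_map φ (fun a b hab => ?_) hreach
      rw [SimpleGraph.deleteEdges_adj] at hab
      rcases hφ2 a b hab.1 (by simpa using hab.2) with h | h
      · rw [h]
      · exact SimpleGraph.Adj.reachable (SimpleGraph.deleteEdges_adj.2 ⟨h.1, by simpa using h.2⟩)
    rw [Sym2.eq_iff] at hφ
    rcases hφ with ⟨h2, h3⟩ | ⟨h2, h3⟩
    · rw [h2, h3] at h1; exact hbr h1
    · rw [h2, h3] at h1; exact hbr h1.symm
  have hr1 : ∀ a k, H.Adj (.inl a) (.inr k) → s(r (.inl a), r (.inr k)) = s(v, w) :=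
    fun a k h => by
      rw [subdivideEdge_adj_inl_inr.1 (hHadj h), hr, subdivideEdgeHom_inl, subdivideEdgeHom_inr,
        mk_edgeEnd]
  have hr2 : ∀ k l, k ≠ l → s(r (.inr k), r (.inr l)) = s(v, w) := fun k l h => by
    have : l = 1 - k := by omega
    rw [hr, subdivideEdgeHom_inr, subdivideEdgeHom_inr, this, mk_edgeEnd]
  -- If the edge lies on the path `v, 0, 1, w`, contract the other edges of this path.
  have key' : ∀ ψ : Fin 2 → W, s(Sum.elim id ψ x, Sum.elim id ψ y) = s(v, w) →
      s(r x, r y) = s(v, w) →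
      (∀ a k, a = edgeEnd v w k → s(.inl a, .inr k) ≠ s(x, y) → a = ψ k) →
      (∀ k l, k ≠ l → s(.inr k, .inr l) ≠ s(x, y) → ψ k = ψ l) → False := by
    intro ψ h1 h2 h3 h4
    refine key (Sum.elim id ψ) (h1.trans h2.symm) ?_
    rintro (a | k) (b | l) hab hne'
    · right
      rw [h2]
      exact ⟨hmap hab, hvw hab⟩
    · exact Or.inl (h3 _ _ (subdivideEdge_adj_inl_inr.1 (hHadj hab)) hne')
    · exact Or.inl (h3 _ _ (subdivideEdge_adj_inr_inl.1 (hHadj hab))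
        (by rwa [Sym2.eq_swap] at hne')).symm
    · exact Or.inl (h4 _ _ (hHadj hab) hne')
  have key1 : ∀ a k, a = edgeEnd v w k → s(x, y) = s(.inl a, .inr k) → s(r x, r y) = s(v, w) →
      False := by
    intro a k hak hs hrs
    -- For an outer edge of the new path, both new vertices go to the far end: this edge is
    -- stretched over `e` and the other two collapse.
    refine key' (fun _ => edgeEnd v w (1 - k)) ?_ hrs ?_ (fun _ _ _ _ => rfl)
    · have := congrArg (Sym2.map (Sum.elim id fun _ : Fin 2 => edgeEnd v w (1 - k))) hs
      rw [Sym2.map_mk, Sym2.map_mk] at this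
      rw [this, hak]
      exact mk_edgeEnd v w k
    · intro a' k' ha' hne'
      have : k' ≠ k := by
        rintro rfl
        exact hne' (by rw [hs, ha', hak])
      have : k' = 1 - k := by omega
      rw [ha', this]
  rcases x with a | k <;> rcases y with b | l
  · refine key r rfl ?_
    rintro (a' | k') (b' | l') hab hne'
    · refine Or.inr ⟨hmap hab, fun h => hne' ?_⟩
      have := congrArg (Sym2.map (Sum.inl : W → W ⊕ Fin 2)) h
      exact this
    · refine Or.inr ⟨hmap hab, ?_⟩
      rw [hr1 _ _ hab]
      exact (hvw hxy).symm
    · refine Or.inr ⟨hmap hab, ?_⟩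
      rw [Sym2.eq_swap, hr1 _ _ hab.symm]
      exact (hvw hxy).symm
    · refine Or.inr ⟨hmap hab, ?_⟩
      rw [hr2 _ _ (hHadj hab)]
      exact (hvw hxy).symm
  · exact key1 a l (subdivideEdge_adj_inl_inr.1 (hHadj hxy)) rfl (hr1 _ _ hxy)
  · exact key1 b k (subdivideEdge_adj_inr_inl.1 (hHadj hxy)) Sym2.eq_swap
      (Sym2.eq_swap.trans (hr1 _ _ hxy.symm))
  · have hkl : k ≠ l := hHadj hxy
    have hl' : l = 1 - k := by omega
    -- For the middle edge, each new vertex goes to the end it is attached to.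
    refine key' (edgeEnd v w) ?_ (hr2 _ _ hkl) (fun a k h _ => h) ?_
    · rw [hl']
      exact mk_edgeEnd v w k
    · intro k' l' hkl' hne'
      refine absurd ?_ hne'
      have h5 : l' = 1 - k' := by omega
      by_cases h : k' = k
      · rw [h5, hl', h]
      · have h6 : k' = l := by omega
        have h7 : l' = k := by omega
        rw [h6, h7, Sym2.eq_swap]

end LoopGraph

/-! ## Folding in Hom complexes -/

theorem OrderContractible.of_forall_le {P : Type*} [PartialOrder P] (m : P) (h : ∀ p, p ≤ m) :
    OrderContractible P :=
  ⟨m, .of_le h⟩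

namespace LoopGraph

variable {V W : Type*}

/-- The list-coloured part of a Hom complex: the values at `x` are taken from the list `Λ x`. -/
abbrev ListHom (T : LoopGraph V) (G : LoopGraph W) (Λ : V → Set W) : Type _ :=
  {η : HomComplex T G // ∀ x, η.toFun x ⊆ Λ x}

namespace ListHom

variable {T : LoopGraph V} {G : LoopGraph W} {Λ : V → Set W}

/-- Applying a folding `φ` of `G` to the values of an order-preserving self-map `g` of
`ListHom T G Λ` does not change the class of `g`. -/
theorem exists_fenced_fold (g : ListHom T G Λ →o ListHom T G Λ) (φ : W → W)
    (hΛ : ∀ η x, ∀ u ∈ (g η).1.toFun x, φ u ∈ Λ x)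
    (hφ : ∀ η x y, T.Adj x y → ∀ u ∈ (g η).1.toFun x, ∀ z ∈ (g η).1.toFun y,
      G.Adj (φ u) z ∧ G.Adj (φ u) (φ z)) :
    ∃ g' : ListHom T G Λ →o ListHom T G Λ, g.Fenced g' ∧
      ∀ η x, (g' η).1.toFun x = φ '' (g η).1.toFun x := by
  -- The fence is `g ≤ g ∪ φ g ≥ φ g`.
  let g₁ : ListHom T G Λ →o ListHom T G Λ :=
    { toFun := fun η => ⟨⟨fun x => (g η).1.toFun x ∪ φ '' (g η).1.toFun x,
        fun x => ((g η).1.nonempty x).inl, by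
          rintro x y hxy u (hu | ⟨u, hu, rfl⟩) z (hz | ⟨z, hz, rfl⟩)
          · exact (g η).1.adj x y hxy u hu z hz
          · exact G.symm _ _ (hφ η y x (T.symm _ _ hxy) z hz u hu).1
          · exact (hφ η x y hxy u hu z hz).1
          · exact (hφ η x y hxy u hu z hz).2⟩, by
        rintro x u (hu | ⟨u, hu, rfl⟩)
        · exact (g η).2 x hu
        · exact hΛ η x u hu⟩
      monotone' := fun η η' h x =>
        Set.union_subset_union (g.monotone h x) (Set.image_mono (g.monotone h x)) }
  let g₂ : ListHom T G Λ →o ListHom T G Λ :=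
    { toFun := fun η => ⟨⟨fun x => φ '' (g η).1.toFun x,
        fun x => ((g η).1.nonempty x).image φ, by
          rintro x y hxy _ ⟨u, hu, rfl⟩ _ ⟨z, hz, rfl⟩
          exact (hφ η x y hxy u hu z hz).2⟩, by
        rintro x _ ⟨u, hu, rfl⟩
        exact hΛ η x u hu⟩
      monotone' := fun η η' h x => Set.image_mono (g.monotone h x) }
  refine ⟨g₂, ?_, fun _ _ => rfl⟩
  have h1 : g ≤ g₁ := fun η x => Set.subset_union_left
  have h2 : g₂ ≤ g₁ := fun η x => Set.subset_union_right
  exact (OrderHom.Fenced.of_le h1).trans (OrderHom.Fenced.of_le h2).symm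

end ListHom

/-! ### Restriction to an edge -/

theorem Connected.induction {T : LoopGraph V} (hT : T.Connected) {p : V → Prop} {b : V} (hb : p b)
    (h : ∀ x y, T.Adj x y → p x → p y) (x : V) : p x := by
  obtain ⟨q⟩ := SimpleGraph.Connected.preconnected hT x b
  induction q with
  | nil => exact hb
  | cons hadj _ ih => exact h _ _ (T.symm _ _ hadj.2) (ih hb)

/-! ### Folding onto the star of a vertex. -/

section Star

variable {T : LoopGraph V} {G : LoopGraph W} {Λ : V → Set W}

/-- Values picked along a walk in `T` form a walk in `G`, so the distances in `T` from `b` bound the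
distances in `G` of all values from `c`. -/
theorem HomComplex.exists_walk (hl : ∀ a, ¬ G.Adj a a) (η : HomComplex T G) {x b : V} {c : W}
    (hb : η.toFun b ⊆ {c}) (p : T.toSimple.Walk x b) :
    ∀ u ∈ η.toFun x, ∃ q : G.toSimple.Walk u c, q.length = p.length := by
  induction p with
  | nil =>
    intro u hu
    have := hb hu
    rw [Set.mem_singleton_iff] at this
    subst this
    exact ⟨.nil, rfl⟩
  | @cons x y b hadj p ih =>
    intro u hu
    obtain ⟨z, hz⟩ := η.nonempty y
    obtain ⟨q, hq⟩ := ih hb z hz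
    exact ⟨.cons ((toSimple_adj_of_no_loop hl).2 (η.adj x y hadj.2 u hu z hz)) q, by simp [hq]⟩

/-- In a graph without short cycles, a vertex which is not too far from `c` and not adjacent to it
can be folded towards `c`. -/
theorem exists_fold_target (hl : ∀ a, ¬ G.Adj a a) {k : ℕ} (hG : G.toSimple.ForestUpTo k) {c u : W}
    (hu : G.toSimple.Reachable c u) (hu2 : 2 ≤ G.toSimple.dist c u)
    (huk : 2 * G.toSimple.dist c u + 2 ≤ k) :
    ∃ u', G.toSimple.dist c u' < G.toSimple.dist c u ∧
      ∀ z, G.Adj u z → G.toSimple.dist c z ≤ G.toSimple.dist c u →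
        G.toSimple.dist c z < G.toSimple.dist c u ∧ G.Adj u' z := by
  have hadj : ∀ {a b}, G.toSimple.Adj a b ↔ G.Adj a b := toSimple_adj_of_no_loop hl
  have huc : u ≠ c := by rintro rfl; simp at hu2
  obtain ⟨p, hpu, hp⟩ := hu.exists_adj_dist_lt huc
  have hcp : G.toSimple.Reachable c p := hu.trans hpu.symm.reachable
  have hpc : p ≠ c := by
    rintro rfl
    have := SimpleGraph.dist_eq_one_iff_adj.2 hpu
    omega
  -- The target is two steps nearer to `c`. The only neighbour of `u` not farther from `c` than `u`
  -- is `p`, and `p` is adjacent to `u'`.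
  obtain ⟨u', hu'p, hu'⟩ := hcp.exists_adj_dist_lt hpc
  refine ⟨u', hu'.trans hp, fun z huz hz => ?_⟩
  have : z = p := hG.eq_of_dist_le hu huk (hadj.2 (G.symm _ _ huz)) hpu hz hp.le
  subst this
  exact ⟨hp, hadj.1 hu'p⟩

/-- All values lie within distance `n` of `c`. Each vertex of the outermost layer is folded two
steps inwards, down to radius `1`. There the two-colouring of `T` forces the value `c` on the colour
of `b` and neighbours of `c` on the other colour, so `μ` is an upper bound. The proper lists sit
inside the star of `c`, which no fold moves. -/
theorem orderContractible_star (hT : T.Connected) {col : V → Bool}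
    (hcol : ∀ x y, T.Adj x y → col x ≠ col y) {b : V} {n : ℕ}
    (hn : ∀ x, T.toSimple.dist b x ≤ n) (hn1 : 1 ≤ n)
    (hl : ∀ a, ¬ G.Adj a a) (hG : G.toSimple.ForestUpTo (2 * n + 2)) {c : W}
    (hb : Λ b = {c}) (hc : {z | G.Adj c z}.Nonempty)
    (hΛ : ∀ x, Λ x = Set.univ ∨ (Λ x = {c} ∧ col x = col b) ∨
      (Λ x ⊆ {z | G.Adj c z} ∧ (Λ x).Nonempty ∧ col x ≠ col b)) :
    OrderContractible (ListHom T G Λ) := by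
  classical
  have hadj : ∀ {a b}, G.toSimple.Adj a b ↔ G.Adj a b := toSimple_adj_of_no_loop hl
  set D := G.toSimple.dist c with hD
  have hreach : ∀ (η : ListHom T G Λ) x, ∀ u ∈ η.1.toFun x, G.toSimple.Reachable c u ∧ D u ≤ n := by
    intro η x u hu
    obtain ⟨p, hp⟩ := (SimpleGraph.Connected.preconnected hT x b).exists_walk_length_eq_dist
    obtain ⟨q, hq⟩ := η.1.exists_walk hl (c := c) (by rw [← hb]; exact η.2 b) p u hu
    refine ⟨q.reverse.reachable, ?_⟩
    have h1 := SimpleGraph.dist_le q.reverse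
    have h2 := hn x
    rw [SimpleGraph.dist_comm] at h2
    rw [SimpleGraph.Walk.length_reverse] at h1
    change G.toSimple.dist c u ≤ n
    omega
  have hD1 : ∀ u, G.toSimple.Reachable c u → D u ≤ 1 → u = c ∨ G.Adj c u := by
    intro u hu h
    rcases Nat.le_one_iff_eq_zero_or_eq_one.1 h with h | h
    · exact Or.inl (hu.dist_eq_zero_iff.1 h).symm
    · exact Or.inr (hadj.1 (SimpleGraph.dist_eq_one_iff_adj.1 h))
  -- the maximum of the part of the complex supported on the star of `c`
  let μ : ListHom T G Λ := ⟨⟨fun x => if col x = col b then {c} else {z | G.Adj c z} ∩ Λ x, by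
      intro x
      split_ifs with h
      · exact Set.singleton_nonempty c
      · rcases hΛ x with h' | h' | h'
        · rwa [h', Set.inter_univ]
        · exact absurd h'.2 h
        · rw [Set.inter_eq_right.2 h'.1]
          exact h'.2.1, by
      intro x y hxy u hu z hz
      have := hcol x y hxy
      split_ifs at hu hz with h1 h2 h2
      · exact absurd (h1.trans h2.symm) this
      · rw [Set.mem_singleton_iff] at hu
        subst hu
        exact hz.1
      · rw [Set.mem_singleton_iff] at hz
        subst hz
        exact G.symm _ _ hu.1
      · exact absurd (by revert h1 h2; cases col x <;> cases col y <;> cases col b <;> simp) this⟩,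
    by
      intro x
      change (if col x = col b then {c} else {z | G.Adj c z} ∩ Λ x) ⊆ Λ x
      split_ifs with h
      · rcases hΛ x with h' | h' | h'
        · rw [h']; exact Set.subset_univ _
        · rw [h'.1]
        · exact absurd h h'.2.2
      · exact Set.inter_subset_right⟩
  have hμ : ∀ η : ListHom T G Λ, (∀ x, ∀ u ∈ η.1.toFun x, D u ≤ 1) → η ≤ μ := by
    intro η hη
    have key : ∀ x, (col x = col b → η.1.toFun x ⊆ {c}) ∧
        (col x ≠ col b → η.1.toFun x ⊆ {z | G.Adj c z}) := by
      refine hT.induction (b := b) ⟨fun _ => by rw [← hb]; exact η.2 b, fun h => absurd rfl h⟩ ?_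
      intro x y hxy ⟨ih1, ih2⟩
      have hxy' := hcol x y hxy
      refine ⟨fun hy u hu => ?_, fun hy u hu => ?_⟩
      · have hx : col x ≠ col b := fun h => hxy' (h.trans hy.symm)
        obtain ⟨z, hz⟩ := η.1.nonempty x
        have hcz : G.Adj c z := ih2 hx hz
        have hzu := η.1.adj x y hxy z hz u hu
        rcases hD1 u (hreach η y u hu).1 (hη y u hu) with h | h
        · exact h
        -- Otherwise `c`, `z`, `u` would form a triangle.
        · have hz1 : D z = 1 := SimpleGraph.dist_eq_one_iff_adj.2 (hadj.2 hcz)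
          refine hG.eq_of_dist_le (hadj.2 hcz).reachable ?_ (hadj.2 (G.symm _ _ hzu))
            (hadj.2 hcz) ?_ ?_
          · rw [← hD, hz1]; omega
          · rw [← hD, hz1]; exact hη y u hu
          · simp
      · have hx : col x = col b := by
          revert hxy' hy; cases col x <;> cases col y <;> cases col b <;> simp
        obtain ⟨z, hz⟩ := η.1.nonempty x
        have hzc : z = c := ih1 hx hz
        subst hzc
        exact η.1.adj x y hxy z hz u hu
    intro x u hu
    change u ∈ if col x = col b then {c} else {z | G.Adj c z} ∩ Λ x
    split_ifs with h
    · exact (key x).1 h hu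
    · exact ⟨(key x).2 h hu, η.2 x hu⟩
  -- The induction runs over arbitrary self-maps, since after one fold the map is no longer the
  -- identity.
  have main : ∀ d, 1 ≤ d → d ≤ n → ∀ g : ListHom T G Λ →o ListHom T G Λ,
      (∀ η x, ∀ u ∈ (g η).1.toFun x, D u ≤ d) → g.Fenced (OrderHom.const _ μ) := by
    intro d hd
    induction d, hd using Nat.le_induction with
    | base => exact fun _ g hg => .of_le fun η => hμ _ (hg η)
    | succ d hd ih =>
      intro hdn g hg
      have hex : ∀ u, ∃ u', (G.toSimple.Reachable c u ∧ D u = d + 1 → D u' < D u ∧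
          ∀ z, G.Adj u z → D z ≤ D u → D z < D u ∧ G.Adj u' z) := by
        intro u
        by_cases h : G.toSimple.Reachable c u ∧ D u = d + 1
        · obtain ⟨u', hu'⟩ := exists_fold_target hl hG h.1 (by rw [← hD]; omega)
            (by rw [← hD]; omega)
          exact ⟨u', fun _ => hu'⟩
        · exact ⟨u, fun h' => absurd h' h⟩
      choose ρ hρ using hex
      let φ : W → W := fun u => if D u = d + 1 then ρ u else u
      obtain ⟨g', hgg', hg'⟩ := ListHom.exists_fenced_fold g φ (by
        intro η x u hu
        -- A vertex that moves has distance at least `2` from `c`, so it can only come from an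
        -- unrestricted list.
        by_cases h : D u = d + 1
        · rcases hΛ x with h' | h' | h'
          · rw [h']; exact Set.mem_univ _
          · have := (g η).2 x hu
            rw [h'.1, Set.mem_singleton_iff] at this
            rw [this] at h
            simp [hD] at h
          · have : D u = 1 := SimpleGraph.dist_eq_one_iff_adj.2 (hadj.2 (h'.1 ((g η).2 x hu)))
            omega
        · simp only [φ, if_neg h]
          exact (g η).2 x hu) (by
        intro η x y hxy u hu z hz
        have huz := (g η).1.adj x y hxy u hu z hz
        have hru := (hreach _ x u hu).1
        have hrz := (hreach _ y z hz).1
        have hdu := hg η x u hu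
        have hdz := hg η y z hz
        by_cases h1 : D u = d + 1
        · have h2 := (hρ u ⟨hru, h1⟩).2 z huz (by omega)
          have h3 : D z ≠ d + 1 := by omega
          simp only [φ, if_pos h1, if_neg h3]
          exact ⟨h2.2, h2.2⟩
        · simp only [φ, if_neg h1]
          refine ⟨huz, ?_⟩
          split_ifs with h2
          · exact G.symm _ _ ((hρ z ⟨hrz, h2⟩).2 u (G.symm _ _ huz) (by omega)).2
          · exact huz)
      refine hgg'.trans (ih (by omega) g' ?_)
      intro η x u hu
      rw [hg'] at hu
      obtain ⟨u, hu, rfl⟩ := hu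
      have hdu := hg η x u hu
      by_cases h1 : D u = d + 1
      · have := (hρ u ⟨(hreach _ x u hu).1, h1⟩).1
        simp only [φ, if_pos h1]
        omega
      · simp only [φ, if_neg h1]
        omega
  exact ⟨μ, main n hn1 le_rfl _ fun η x u hu => (hreach η x u hu).2⟩

end Star

/-- The graph with two vertices and one edge. -/
def edgeGraph : LoopGraph Bool where
  Adj := (· ≠ ·)
  symm _ _ := Ne.symm

/-- The restriction `Hom(T, G) → Hom(K₂, G)` to the edge `⟨h false, h true⟩` of `T`. -/
def HomComplex.restrict (T : LoopGraph V) (G : LoopGraph W) (h : edgeGraph.Adj →r T.Adj) :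
    HomComplex T G →o HomComplex edgeGraph G where
  toFun η := ⟨fun i => η.toFun (h i), fun i => η.nonempty (h i),
    fun _ _ hij => η.adj _ _ (h.map_rel hij)⟩
  monotone' _ _ hle i := hle (h i)

/-- In a graph without short cycles, a multi-homomorphism from `K₂` is a star. -/
theorem HomComplex.exists_eq_singleton {G : LoopGraph W} (hl : ∀ a, ¬ G.Adj a a)
    (hG : G.toSimple.ForestUpTo 6) (ζ : HomComplex edgeGraph G) :
    ∃ i c, ζ.toFun i = {c} := by
  have hadj : ∀ {a b}, G.toSimple.Adj a b ↔ G.Adj a b := toSimple_adj_of_no_loop hl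
  by_contra hcon
  push Not at hcon
  have key : ∀ i, ∃ a ∈ ζ.toFun i, ∃ a' ∈ ζ.toFun i, a' ≠ a := by
    intro i
    obtain ⟨a, ha⟩ := ζ.nonempty i
    refine ⟨a, ha, ?_⟩
    by_contra h
    push Not at h
    exact hcon i a (Set.eq_singleton_iff_unique_mem.2 ⟨ha, h⟩)
  obtain ⟨a, ha, a', ha', hne⟩ := key false
  obtain ⟨b, hb, b', hb', hne'⟩ := key true
  have hab : ∀ a ∈ ζ.toFun false, ∀ b ∈ ζ.toFun true, G.toSimple.Adj a b :=
    fun a ha b hb => hadj.2 (ζ.adj false true (by simp [edgeGraph]) a ha b hb)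
  have h1 := hab a ha b hb
  have h2 := hab a' ha' b hb
  have h3 := hab a ha b' hb'
  have h4 := hab a' ha' b' hb'
  have hr : G.toSimple.Reachable a' a := h2.reachable.trans h1.symm.reachable
  have hd : G.toSimple.dist a' a ≤ 2 :=
    SimpleGraph.dist_le (.cons h2 (.cons h1.symm .nil))
  have hpos := hr.pos_dist_of_ne hne
  -- Two values at both ends would give a 4-cycle: `b` and `b'` are both neighbours of `a` towards
  -- `a'`. Since `a` and `a'` are at distance at most `2`, the edge bound needed is `2 * 2 + 2 = 6`.
  refine hne' (hG.eq_of_dist_le hr (by omega) h3.symm h1.symm ?_ ?_)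
  · rw [SimpleGraph.dist_eq_one_iff_adj.2 h4]; omega
  · rw [SimpleGraph.dist_eq_one_iff_adj.2 h2]; omega

/-- The fiber over a star `ζ` centred at `c` is a list-coloured complex: list `{c}` at one end of
the edge, neighbours of `c` at the other, no restriction elsewhere. Hence `orderContractible_star`
applies. -/
theorem HomComplex.isPosetHomotopyEquiv_restrict [Finite V] [Finite W] {T : LoopGraph V}
    {G : LoopGraph W} (hT : T.Connected) (hbip : T.IsBipartite) {n : ℕ}
    (hn : ∀ x y, T.toSimple.dist x y ≤ n) (hn2 : 2 ≤ n) (hl : ∀ a, ¬ G.Adj a a)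
    (hG : G.toSimple.ForestUpTo (2 * n + 2)) (h : edgeGraph.Adj →r T.Adj) :
    IsPosetHomotopyEquiv (HomComplex.restrict T G h) := by
  classical
  obtain ⟨col, hcol⟩ := hbip
  refine IsPosetHomotopyEquiv.of_fibers _ fun ζ => ?_
  obtain ⟨i, c, hi⟩ := ζ.exists_eq_singleton hl
    fun H hH hk => hG H hH (hk.trans (by exact_mod_cast (by omega)))
  have hnot : ∀ j, j = i ∨ j = !i := by
    intro j; cases i <;> cases j <;> simp
  have hiadj : edgeGraph.Adj i (!i) := by simp [edgeGraph]
  have hcolne : col (h (!i)) ≠ col (h i) := (hcol _ _ (h.map_rel hiadj)).symm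
  have hhne : h (!i) ≠ h i := fun h' => hcolne (congrArg col h')
  let Λ : V → Set W := fun x => if x = h i then {c} else if x = h (!i) then ζ.toFun (!i)
    else Set.univ
  have hΛi : Λ (h i) = {c} := if_pos rfl
  have hΛni : Λ (h (!i)) = ζ.toFun (!i) := by simp only [Λ, if_neg hhne, if_true]
  have hcζ : ζ.toFun (!i) ⊆ {z | G.Adj c z} := fun z hz =>
    ζ.adj i (!i) hiadj c (by rw [hi]; rfl) z hz
  have hset : ∀ η : HomComplex T G, (∀ x, η.toFun x ⊆ Λ x) ↔ HomComplex.restrict T G h η ≤ ζ := by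
    intro η
    constructor
    · intro hη j
      change η.toFun (h j) ⊆ ζ.toFun j
      have := hη (h j)
      rcases hnot j with rfl | rfl
      · rwa [hΛi, ← hi] at this
      · rwa [hΛni] at this
    · intro hη x
      change ∀ j, η.toFun (h j) ⊆ ζ.toFun j at hη
      by_cases h1 : x = h i
      · rw [h1, hΛi, ← hi]; exact hη i
      · by_cases h2 : x = h (!i)
        · rw [h2, hΛni]; exact hη _
        · simp only [Λ, if_neg h1, if_neg h2]
          exact Set.subset_univ _
  have hcontr : OrderContractible (ListHom T G Λ) := by
    refine orderContractible_star hT hcol (hn (h i)) (by omega) hl hG hΛi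
      ((ζ.nonempty (!i)).mono hcζ) fun x => ?_
    by_cases h1 : x = h i
    · rw [h1]; exact Or.inr (Or.inl ⟨hΛi, rfl⟩)
    · by_cases h2 : x = h (!i)
      · rw [h2, hΛni]
        exact Or.inr (Or.inr ⟨hcζ, ζ.nonempty _, hcolne⟩)
      · exact Or.inl (by simp only [Λ, if_neg h1, if_neg h2])
  exact hcontr.of_orderIso ⟨Equiv.subtypeEquivRight hset, Iff.rfl⟩

/-! ### Subdividing an edge -/

theorem exists_edgeEnd {v w a b : W} (h : s(a, b) = s(v, w)) :
    ∃ k, a = edgeEnd v w k ∧ b = edgeEnd v w (1 - k) := by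
  rcases Sym2.eq_iff.1 h with ⟨rfl, rfl⟩ | ⟨rfl, rfl⟩
  · exact ⟨0, rfl, rfl⟩
  · exact ⟨1, rfl, rfl⟩

/-! ### Fibers of `Hom(K₂, X_e) → Hom(K₂, X)`. -/

section EdgeFiber

variable {X : LoopGraph W} {v w : W}

/-- Every edge at a new vertex is sent to `e`, so new vertices cannot occur as values, and the copy
of `ζ` on the old vertices is the maximum. -/
theorem orderContractible_edgeFiber_of_notMem (e : X.Adj v w) {i : Bool}
    {c : W} {ζ : HomComplex edgeGraph X} (hi : ζ.toFun i = {c})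
    (hno : ∀ b ∈ ζ.toFun (!i), s(c, b) ≠ s(v, w)) :
    OrderContractible (ListHom edgeGraph (X.subdivideEdge v w)
      fun j => X.subdivideEdgeHom e ⁻¹' ζ.toFun j) := by
  have hiadj : edgeGraph.Adj i (!i) := by simp [edgeGraph]
  have hcB : ∀ b ∈ ζ.toFun (!i), X.Adj c b := fun b hb =>
    ζ.adj i (!i) hiadj c (by rw [hi]; rfl) b hb
  refine OrderContractible.of_forall_le ⟨⟨fun j => Sum.inl '' ζ.toFun j,
    fun j => (ζ.nonempty j).image _, ?_⟩, ?_⟩ ?_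
  · rintro j j' hjj' _ ⟨a, ha, rfl⟩ _ ⟨b, hb, rfl⟩
    refine ⟨ζ.adj j j' hjj' a ha b hb, ?_⟩
    have hjj'' : j ≠ j' := hjj'
    by_cases hj : j = i
    · have hj' : j' = !i := by revert hjj''; rw [hj]; cases i <;> cases j' <;> simp
      subst hj hj'
      rw [hi] at ha
      rw [Set.mem_singleton_iff.1 ha]
      exact hno b hb
    · have hj1 : j = !i := by revert hj; cases i <;> cases j <;> simp
      have hj2 : j' = i := by revert hjj''; rw [hj1]; cases i <;> cases j' <;> simp
      subst hj1 hj2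
      rw [hi] at hb
      rw [Set.mem_singleton_iff.1 hb, Sym2.eq_swap]
      exact hno a ha
  · rintro j _ ⟨a, ha, rfl⟩
    exact ha
  · intro ξ
    have hmem : ∀ j x, x ∈ ξ.1.toFun j → X.subdivideEdgeHom e x ∈ ζ.toFun j :=
      fun j x hx => ξ.2 j hx
    have hnew : ∀ x ∈ ξ.1.toFun i, ∀ y ∈ ξ.1.toFun (!i), (∃ a, x = .inl a) ∧ ∃ b, y = .inl b := by
      intro x hx y hy
      have hxy := ξ.1.adj i (!i) hiadj x hx y hy
      have hx' := hmem i x hx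
      rw [hi, Set.mem_singleton_iff] at hx'
      have hy' := hmem _ y hy
      have hs := hno _ hy'
      rw [← hx'] at hs
      rcases x with a | k <;> rcases y with b | l
      · exact ⟨⟨a, rfl⟩, ⟨b, rfl⟩⟩
      · exfalso
        rw [subdivideEdge_adj_inl_inr.1 hxy, subdivideEdgeHom_inl, subdivideEdgeHom_inr,
          mk_edgeEnd] at hs
        exact hs rfl
      · exfalso
        rw [subdivideEdge_adj_inr_inl.1 hxy, subdivideEdgeHom_inl, subdivideEdgeHom_inr,
          Sym2.eq_swap, mk_edgeEnd] at hs
        exact hs rfl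
      · exfalso
        have hkl : k ≠ l := hxy
        have : l = 1 - k := by omega
        rw [this, subdivideEdgeHom_inr, subdivideEdgeHom_inr, mk_edgeEnd] at hs
        exact hs rfl
    intro j x hx
    have : ∃ a, x = .inl a := by
      by_cases hj : j = i
      · subst hj
        obtain ⟨y, hy⟩ := ξ.1.nonempty (!j)
        exact (hnew x hx y hy).1
      · have hj : j = !i := by revert hj; cases i <;> cases j <;> simp
        subst hj
        obtain ⟨y, hy⟩ := ξ.1.nonempty i
        exact (hnew y hy x hx).2
    obtain ⟨a, rfl⟩ := this
    exact ⟨a, hmem j _ hx, rfl⟩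

theorem edgeGraph_forall_adj {p : Bool → Bool → Prop} (i : Bool) (h1 : p i (!i))
    (h2 : p (!i) i) : ∀ j j', edgeGraph.Adj j j' → p j j' := by
  intro j j' h
  have h' : j ≠ j' := h
  cases i <;> cases j <;> cases j' <;> first | exact absurd rfl h' | assumption

/-- Over the star the allowed vertices form a tree: the rays from `c` other than `e`, and the path
`c`, `inr k`, `inr (1 - k)`, `b₀`. Folding `b₀` to `inr k`, then `inr (1 - k)` to `c`, leaves a star
centred at `c`, with maximum `μ`. -/
theorem orderContractible_edgeFiber_of_mem (hl : ∀ a, ¬ X.Adj a a) (e : X.Adj v w) {i : Bool}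
    {ζ : HomComplex edgeGraph X} {k : Fin 2} (hi : ζ.toFun i = {edgeEnd v w k})
    (hk : edgeEnd v w (1 - k) ∈ ζ.toFun (!i)) :
    OrderContractible (ListHom edgeGraph (X.subdivideEdge v w)
      fun j => X.subdivideEdgeHom e ⁻¹' ζ.toFun j) := by
  classical
  set c := edgeEnd v w k with hc
  set b₀ := edgeEnd v w (1 - k) with hb₀
  set G := X.subdivideEdge v w with hG
  have hiadj : edgeGraph.Adj i (!i) := by simp [edgeGraph]
  have hcB : ∀ b ∈ ζ.toFun (!i), X.Adj c b := fun b hb =>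
    ζ.adj i (!i) hiadj c (by rw [hi]; rfl) b hb
  have hkk : (1 : Fin 2) - (1 - k) = k := by omega
  have hcb₀ : c ≠ b₀ := fun h => hl c (by have := hcB b₀ hk; rwa [← h] at this)
  have h2cases : ∀ l : Fin 2, l = k ∨ l = 1 - k := by intro l; omega
  have hkne : (1 - k : Fin 2) ≠ k := by omega
  -- the two lists
  have hx : ∀ x : W ⊕ Fin 2, X.subdivideEdgeHom e x ∈ ζ.toFun i →
      x = .inl c ∨ x = .inr (1 - k) := by
    rintro (a | l) h
    · rw [hi] at h
      exact Or.inl (congrArg Sum.inl h)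
    · rcases h2cases l with rfl | rfl
      · rw [hi, subdivideEdgeHom_inr] at h
        exact absurd h.symm hcb₀
      · exact Or.inr rfl
  have hy : ∀ y : W ⊕ Fin 2, X.subdivideEdgeHom e y ∈ ζ.toFun (!i) →
      (∃ b ∈ ζ.toFun (!i), y = .inl b) ∨ y = .inr k := by
    rintro (a | l) h
    · exact Or.inl ⟨a, h, rfl⟩
    · rcases h2cases l with rfl | rfl
      · exact Or.inr rfl
      · rw [subdivideEdgeHom_inr, hkk] at h
        exact absurd (hcB _ h) (hl c)
  -- adjacencies
  have A1 : G.Adj (.inl c) (.inr k) := subdivideEdge_adj_inl_inr.2 rfl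
  have A2 : G.Adj (.inr (1 - k)) (.inr k) := hkne
  have A3 : ∀ b ∈ ζ.toFun (!i), b ≠ b₀ → G.Adj (.inl c) (.inl b) := by
    intro b hb hbb
    refine ⟨hcB b hb, fun h => hbb ?_⟩
    rw [← mk_edgeEnd v w k] at h
    rcases Sym2.eq_iff.1 h with h | h
    · exact h.2
    · exact absurd h.1 hcb₀
  have hcl : X.subdivideEdgeHom e (.inl c) ∈ ζ.toFun i := by
    rw [hi]; rfl
  have hkl : X.subdivideEdgeHom e (.inr k) ∈ ζ.toFun (!i) := by
    rw [subdivideEdgeHom_inr]; exact hk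
  -- fold `b₀` to the new vertex next to `c`
  let φ₁ : W ⊕ Fin 2 → W ⊕ Fin 2 := fun y => if y = .inl b₀ then .inr k else y
  have hφ₁x : ∀ x, X.subdivideEdgeHom e x ∈ ζ.toFun i → φ₁ x = x := by
    intro x h
    rcases hx x h with rfl | rfl
    · exact if_neg fun h => hcb₀ (Sum.inl_injective h)
    · exact if_neg (by simp)
  have hφ₁y : ∀ y, X.subdivideEdgeHom e y ∈ ζ.toFun (!i) →
      (∃ b ∈ ζ.toFun (!i), b ≠ b₀ ∧ φ₁ y = .inl b) ∨ φ₁ y = .inr k := by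
    intro y h
    rcases hy y h with ⟨b, hb, rfl⟩ | rfl
    · by_cases hbb : b = b₀
      · exact Or.inr (if_pos (by rw [hbb]))
      · exact Or.inl ⟨b, hb, hbb, if_neg fun h => hbb (Sum.inl_injective h)⟩
    · exact Or.inr (if_neg (by simp))
  have hφ₁adj : ∀ x y, X.subdivideEdgeHom e x ∈ ζ.toFun i →
      X.subdivideEdgeHom e y ∈ ζ.toFun (!i) → G.Adj x y → G.Adj x (φ₁ y) := by
    intro x y h1 h2 hxy
    by_cases h : y = .inl b₀
    · simp only [φ₁, if_pos h]
      rcases hx x h1 with rfl | rfl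
      · exact A1
      · exact A2
    · simp only [φ₁, if_neg h]
      exact hxy
  obtain ⟨g₁, hg₁, hg₁'⟩ := ListHom.exists_fenced_fold (OrderHom.id : ListHom edgeGraph G
    (fun j => X.subdivideEdgeHom e ⁻¹' ζ.toFun j) →o _) φ₁ (by
      intro ξ j x hxj
      have h1 : X.subdivideEdgeHom e x ∈ ζ.toFun j := ξ.2 j hxj
      by_cases hj : j = i
      · subst hj
        rw [Set.mem_preimage]
        rw [hφ₁x x h1]
        exact h1
      · have hj : j = !i := by revert hj; cases i <;> cases j <;> simp
        subst hj
        rcases hφ₁y x h1 with ⟨b, hb, -, h2⟩ | h2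
        · rw [Set.mem_preimage, h2]; exact hb
        · rw [Set.mem_preimage, h2]; exact hkl) (by
      intro ξ
      refine edgeGraph_forall_adj i ?_ ?_
      · intro x hxi y hyi
        have hxy := ξ.1.adj i (!i) hiadj x hxi y hyi
        have := hφ₁adj x y (ξ.2 i hxi) (ξ.2 _ hyi) hxy
        rw [hφ₁x x (ξ.2 i hxi)]
        exact ⟨hxy, this⟩
      · intro y hyi x hxi
        have hxy := ξ.1.adj i (!i) hiadj x hxi y hyi
        have := hφ₁adj x y (ξ.2 i hxi) (ξ.2 _ hyi) hxy
        rw [hφ₁x x (ξ.2 i hxi)]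
        exact ⟨G.symm _ _ this, G.symm _ _ this⟩)
  -- the maximum of what is left
  let μ : ListHom edgeGraph G (fun j => X.subdivideEdgeHom e ⁻¹' ζ.toFun j) :=
    ⟨⟨fun j => if j = i then {.inl c} else
        insert (.inr k) (Sum.inl '' (ζ.toFun (!i) \ {b₀})), fun j => by
        split_ifs
        · exact Set.singleton_nonempty _
        · exact Set.insert_nonempty _ _, by
        have key : ∀ y ∈ (insert (.inr k) (Sum.inl '' (ζ.toFun (!i) \ {b₀})) : Set (W ⊕ Fin 2)),
            G.Adj (.inl c) y := by
          rintro y (rfl | ⟨b, ⟨hb, hbb⟩, rfl⟩)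
          · exact A1
          · exact A3 b hb hbb
        refine edgeGraph_forall_adj i ?_ ?_
        · rw [if_pos rfl, if_neg (by simp)]
          rintro x rfl y hy
          exact key y hy
        · rw [if_pos rfl, if_neg (by simp)]
          rintro y hy x rfl
          exact G.symm _ _ (key y hy)⟩, by
      intro j y hyj
      change y ∈ if j = i then {Sum.inl c} else
        (insert (.inr k) (Sum.inl '' (ζ.toFun (!i) \ {b₀})) : Set (W ⊕ Fin 2)) at hyj
      rw [Set.mem_preimage]
      by_cases hj : j = i
      · rw [if_pos hj, Set.mem_singleton_iff] at hyj
        rw [hyj, hj]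
        exact hcl
      · rw [if_neg hj] at hyj
        have hj : j = !i := by revert hj; cases i <;> cases j <;> simp
        subst hj
        rcases hyj with rfl | ⟨b, ⟨hb, hbb⟩, rfl⟩
        · exact hkl
        · exact hb⟩
  -- fold the remaining new vertex to `c`
  let φ₂ : W ⊕ Fin 2 → W ⊕ Fin 2 := fun x => if x = .inr (1 - k) then .inl c else x
  have hφ₂x : ∀ x, X.subdivideEdgeHom e x ∈ ζ.toFun i → φ₂ x = .inl c := by
    intro x h
    rcases hx x h with rfl | rfl
    · exact if_neg (by simp)
    · exact if_pos rfl
  have hg₁y : ∀ ξ, ∀ y ∈ (g₁ ξ).1.toFun (!i),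
      φ₂ y = y ∧ y ∈ (insert (.inr k) (Sum.inl '' (ζ.toFun (!i) \ {b₀})) : Set (W ⊕ Fin 2)) := by
    intro ξ y hyi
    rw [hg₁'] at hyi
    obtain ⟨y, hyi, rfl⟩ := hyi
    rcases hφ₁y y (ξ.2 _ hyi) with ⟨b, hb, hbb, h⟩ | h
    · rw [h]
      exact ⟨if_neg (by simp), Or.inr ⟨b, ⟨hb, hbb⟩, rfl⟩⟩
    · rw [h]
      exact ⟨if_neg fun h => hkne (Sum.inr_injective h).symm, Or.inl rfl⟩
  have hadj₂ : ∀ ξ, ∀ y ∈ (g₁ ξ).1.toFun (!i), G.Adj (.inl c) y := by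
    intro ξ y hyi
    rcases (hg₁y ξ y hyi).2 with rfl | ⟨b, ⟨hb, hbb⟩, rfl⟩
    · exact A1
    · exact A3 b hb hbb
  obtain ⟨g₂, hg₂, hg₂'⟩ := ListHom.exists_fenced_fold g₁ φ₂ (by
      intro ξ j x hxj
      by_cases hj : j = i
      · subst hj
        rw [Set.mem_preimage]
        rw [hφ₂x x ((g₁ ξ).2 j hxj)]
        exact hcl
      · have hj : j = !i := by revert hj; cases i <;> cases j <;> simp
        subst hj
        rw [(hg₁y ξ x hxj).1]
        exact (g₁ ξ).2 _ hxj) (by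
      intro ξ
      refine edgeGraph_forall_adj i ?_ ?_
      · intro x hxi y hyi
        rw [hφ₂x x ((g₁ ξ).2 i hxi), (hg₁y ξ y hyi).1]
        exact ⟨hadj₂ ξ y hyi, hadj₂ ξ y hyi⟩
      · intro y hyi x hxi
        rw [hφ₂x x ((g₁ ξ).2 i hxi), (hg₁y ξ y hyi).1]
        exact ⟨(g₁ ξ).1.adj _ _ hiadj.symm y hyi x hxi, G.symm _ _ (hadj₂ ξ y hyi)⟩)
  refine ⟨μ, (hg₁.trans hg₂).trans (.of_le fun ξ j x hxj => ?_)⟩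
  change x ∈ if j = i then {Sum.inl c} else
    (insert (.inr k) (Sum.inl '' (ζ.toFun (!i) \ {b₀})) : Set (W ⊕ Fin 2))
  have hxj' : x ∈ (g₂ ξ).1.toFun j := hxj
  rw [hg₂'] at hxj'
  obtain ⟨y, hyj, rfl⟩ := hxj'
  by_cases hj : j = i
  · subst hj
    rw [if_pos rfl]
    exact hφ₂x y ((g₁ ξ).2 j hyj)
  · rw [if_neg hj]
    have hj : j = !i := by revert hj; cases i <;> cases j <;> simp
    subst hj
    rw [(hg₁y ξ y hyj).1]
    exact (hg₁y ξ y hyj).2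

end EdgeFiber

theorem HomComplex.isPosetHomotopyEquiv_map_edgeGraph [Finite W] {X : LoopGraph W}
    (hl : ∀ a, ¬ X.Adj a a) (hX : X.toSimple.ForestUpTo 6) {v w : W} (e : X.Adj v w) :
    IsPosetHomotopyEquiv (HomComplex.map edgeGraph (X.subdivideEdgeHom e)) := by
  refine IsPosetHomotopyEquiv.of_fibers _ fun ζ => ?_
  have hset : ∀ ξ : HomComplex edgeGraph (X.subdivideEdge v w),
      (∀ j, ξ.toFun j ⊆ X.subdivideEdgeHom e ⁻¹' ζ.toFun j) ↔
        HomComplex.map edgeGraph (X.subdivideEdgeHom e) ξ ≤ ζ :=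
    fun ξ => forall_congr' fun j => Set.image_subset_iff.symm
  suffices h : OrderContractible (ListHom edgeGraph (X.subdivideEdge v w)
      fun j => X.subdivideEdgeHom e ⁻¹' ζ.toFun j) from
    h.of_orderIso ⟨Equiv.subtypeEquivRight hset, Iff.rfl⟩
  obtain ⟨i, c, hi⟩ := ζ.exists_eq_singleton hl hX
  by_cases hno : ∀ b ∈ ζ.toFun (!i), s(c, b) ≠ s(v, w)
  · exact orderContractible_edgeFiber_of_notMem e hi hno
  · push Not at hno
    obtain ⟨b, hb, hcb⟩ := hno
    obtain ⟨k, rfl, rfl⟩ := exists_edgeEnd hcb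
    exact orderContractible_edgeFiber_of_mem hl e hi hb

end LoopGraph

theorem proposition4p5 {V W : Type*} [Finite V] [Finite W]
    (T : LoopGraph V) (hconn : T.Connected) (hbip : T.IsBipartite) (hdiam : 0 < T.diam)
    (X : LoopGraph W) (hgirth : ((2 * T.diam + 4 : ℕ) : ℕ∞) < X.girth)
    (v w : W) (e : X.Adj v w) :
    IsPosetHomotopyEquiv (LoopGraph.HomComplex.map T (X.subdivideEdgeHom e)) := by
  obtain ⟨hl, hlt⟩ := LoopGraph.no_loop_of_lt_girth (by omega) hgirth
  -- Taking `n = Δ + 1` uses the girth bound in full, as `2 * n + 2 = 2 * Δ + 4`. Since `Δ > 0`,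
  -- this is at least the `6` required to recognise stars.
  have hX : X.toSimple.ForestUpTo (2 * (T.diam + 1) + 2) :=
    SimpleGraph.ForestUpTo.of_lt_egirth hlt
  have hXe := LoopGraph.forestUpTo_subdivideEdge hl e hX
  -- An infinite `ediam` would give `diam` its default value `0`.
  have htop : T.toSimple.ediam ≠ ⊤ := fun h => by
    unfold LoopGraph.diam SimpleGraph.diam at hdiam
    simp [h] at hdiam
  have hdist : ∀ x y, T.toSimple.dist x y ≤ T.diam + 1 := fun x y =>
    (SimpleGraph.dist_le_diam htop).trans (Nat.le_succ _)
  obtain ⟨s, t, hst⟩ : ∃ s t, T.Adj s t := by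
    by_contra hno
    push Not at hno
    have hbot : T.toSimple = ⊥ := by
      ext a b
      exact ⟨fun h => hno a b h.2, fun h => h.elim⟩
    unfold LoopGraph.diam at hdiam
    rw [hbot] at hdiam
    simp at hdiam
  let h : LoopGraph.edgeGraph.Adj →r T.Adj := ⟨fun i => cond i t s, by
    rintro (_ | _) (_ | _) hij
    · exact absurd rfl hij
    · exact hst
    · exact T.symm _ _ hst
    · exact absurd rfl hij⟩
  have h1 := LoopGraph.HomComplex.isPosetHomotopyEquiv_restrict hconn hbip hdist (by omega) hl hX h
  have h2 := LoopGraph.HomComplex.isPosetHomotopyEquiv_restrict hconn hbip hdist (by omega)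
    (LoopGraph.subdivideEdge_no_loop (v := v) (w := w) hl) hXe h
  have h3 := LoopGraph.HomComplex.isPosetHomotopyEquiv_map_edgeGraph hl
    (fun H hH hk => hX H hH (hk.trans (by exact_mod_cast (by omega)))) e
  -- The square commutes definitionally: restricting to the edge and applying `r_e` to values can be
  -- done in either order.
  exact IsPosetHomotopyEquiv.of_comp_left h1 (h3.comp h2 :)
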